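/- **Theorem 3.8.** A word is a finite sequence of positive integers; $|w|$ is its length and $\|w\|$ the sum of its letters. For words $u,w$, the embedding set $Em(u,w)$ is the set of positions $p\ge 1$ such that the factor of $w$ of length $|u|$ starting at position $p$ exists and dominates $u$ letter by letter, i.e. $u_i\le w_{p+i-1}$ for all $1\le i\le |u|$. Two words $u,v$ are super-strongly Wilf equivalent if there is a bijection $f$ from the set of all words to itself such that $|f(w)|=|w|$, $\|f(w)\|=\|w\|$ and $Em(u,w)=Em(v,f(w))$ for every word $w$. Let $\mathcal S_n$ be the set of permutations of $[n]=\{1,\dots,n\}$, written as words, and let $s_{j,n}$ be the number of super-strong Wilf equivalence classes in $\mathcal S_n$ that have exactly $2^j$ elements. Call a finite set $\{x_1<x_2<\dots<x_l\}$ of positive integers with $l\ge 2$ periodic if $x_2-x_1=x_3-x_2=\dots=x_l-x_{l-1}$. For $1\le k\le n-2$, let $d_{k,n}$ be the number of words $u=u_1\cdots u_k$ with distinct letters in $[n]$ such that $[n]\setminus\{u_1,\dots,u_k\}$ is periodic and $[n]\setminus\{u_1,\dots,u_i\}$ is not periodic for any $1\le i<k$. Then for all integers $n\ge 4$ and $1\le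 j\le n-1$, $$ s_{j,n} = s_{j-1,n-1} + \sum_{k=2}^{n-j-1} d_{k,n}\, s_{j,n-k}, $$ where the sum is $0$ if $n-j-1<2$. -/

import Mathlib

namespace SuperStrongWilf

/-- Words on the alphabet of positive integers. -/
abbrev Word : Type := List ℕ+

/-- The height (norm) of a word: the sum of its letters. -/
def height (w : Word) : ℕ := (w.map (fun a : ℕ+ => (a : ℕ))).sum

/-- The embedding index set of `u` into `w`: the (1-based) starting positions `j` of the factors
`v` of `w` that have the same length as `u` and dominate `u` letter by letter. -/
def Em (u w : Word) : Set ℕ :=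
  {j | ∃ s v t : Word, w = s ++ v ++ t ∧ j = s.length + 1 ∧ List.Forall₂ (· ≤ ·) u v}

/-- Super-strong Wilf equivalence: there is a bijection of the set of all words onto itself that
preserves the weight (length and height) and carries embeddings of `u` to embeddings of `v`. -/
def SSWilf (u v : Word) : Prop :=
  ∃ f : Word ≃ Word,
    (∀ w, (f w).length = w.length ∧ height (f w) = height w) ∧ ∀ w, Em u w = Em v (f w)

/-- The permutations on `n` letters, as words: no letter is repeated and the set of letters
is `{1, …, n}`. -/
def Sym (n : ℕ) : Set Word :=
  {w | w.Nodup ∧ ∀ a : ℕ+, a ∈ w ↔ (a : ℕ) ≤ n}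

/-- The super-strong Wilf equivalence class in `Sym n` of the word `u`. -/
def ssClass (n : ℕ) (u : Word) : Set Word := {v ∈ Sym n | SSWilf u v}

/-- `s_{j,n}`: the number of super-strong Wilf equivalence classes in `Sym n` that have exactly
`2 ^ j` elements. -/
noncomputable def s (j n : ℕ) : ℕ :=
  {C : Set Word | (∃ u ∈ Sym n, C = ssClass n u) ∧ C.ncard = 2 ^ j}.ncard

/-- The vector of consecutive differences of a finite set of numbers
`x₁ < x₂ < ⋯ < xₖ`, that is `(x₂ - x₁, …, xₖ - xₖ₋₁)`. -/
def consecDiffs (A : Finset ℕ) : List ℕ :=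
  List.zipWith (fun x y => y - x) (A.sort (· ≤ ·)) (A.sort (· ≤ ·)).tail

/-- A finite set with at least two elements is periodic if its vector of consecutive differences is
`(d, d, …, d)` for some positive integer `d`. -/
def Periodic (A : Finset ℕ) : Prop :=
  2 ≤ A.card ∧ ∃ d : ℕ, 0 < d ∧ consecDiffs A = List.replicate (A.card - 1) d

/-- The set `{1, …, n}` with the letters of `u` removed. -/
def remaining (n : ℕ) (u : Word) : Finset ℕ :=
  Finset.Icc 1 n \ (u.map (fun a : ℕ+ => (a : ℕ))).toFinset

/-- `D_{i,n}`: the prefixes `u` of length `i` of permutations on `n` letters for which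
`{1, …, n}` without the letters of `u` is periodic, while this fails for all
shorter nonempty prefixes of `u`. -/
def D (i n : ℕ) : Set Word :=
  {u | u.length = i ∧ (∃ w ∈ Sym n, u <+: w) ∧ Periodic (remaining n u) ∧
    ∀ j, 1 ≤ j → j < i → ¬ Periodic (remaining n (u.take j))}

/-- `d_{i,n}`, the number of elements of `D_{i,n}`. -/
noncomputable def d (i n : ℕ) : ℕ := (D i n).ncard

end SuperStrongWilf

/-! Fix `u` in `Sym n`. The least word of given length in which `u` embeds at all positions of `E`
has height `L + ∑ i ≥ 2, |levelSet u i + E|`, where `levelSet u i` is the set of positions of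
letters at least `i`. Two permutations are super-strongly Wilf equivalent exactly when these heights
agree for all `E`, and this happens exactly when their level sets are translates, level by level
(`sSWilf_iff_translate_levelSet`). For the inverse permutation, read as a list of positions, the
level sets are the sets of entries of its suffixes, up to a shift by 1.

So a class is counted by deleting positions one at a time. If `A` and `B` are translates and `a` is
deleted from `A`, there are two matching deletions from `B` when `A` is an arithmetic progression
with end `a`, and one otherwise (`card_filter_translate_erase`). Hence the class has `2 ^ endCount`
elements, with `endCount` evaluated on the inverse, and `2 ^ j * s j n` is the number of orderings
of `{1, …, n}` with `endCount = j` (`two_pow_mul_s`).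

These orderings satisfy the recurrence (`endCountCard_Icc`). If the first entry is 1 or `n`, one end
is counted and an interval of `n - 1` elements remains. Otherwise nothing is counted until a
progression first reappears, after `k ≥ 2` deletions; there are `d k n` such beginnings, and by
affine invariance the remaining progression behaves like `{1, …, n - k}`. Dividing by `2 ^ j` gives
the theorem. -/

namespace SuperStrongWilf

open Finset
open scoped Pointwise

/-! ### Translates of finite sets. -/

/-- Two finite sets of numbers are translates of each other. -/
def Translate (A B : Finset ℕ) : Prop := ∃ c c' : ℕ, A + {c} = B + {c'}

theorem Translate.refl (A : Finset ℕ) : Translate A A := ⟨0, 0, rfl⟩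

theorem Translate.symm {A B : Finset ℕ} (h : Translate A B) : Translate B A := by
  obtain ⟨c, c', h⟩ := h
  exact ⟨c', c, h.symm⟩

theorem Translate.trans {A B C : Finset ℕ} (h : Translate A B) (h' : Translate B C) :
    Translate A C := by
  obtain ⟨c, c', h⟩ := h
  obtain ⟨k, k', h'⟩ := h'
  refine ⟨c + k, k' + c', ?_⟩
  rw [← singleton_add_singleton, ← singleton_add_singleton, ← add_assoc, ← add_assoc, h, ← h',
    add_right_comm]

theorem translate_add_singleton (A : Finset ℕ) (c : ℕ) : Translate (A + {c}) A :=
  ⟨0, c, by rw [add_assoc, singleton_add_singleton, add_zero]⟩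

theorem translate_add_singleton_iff {A B : Finset ℕ} {c : ℕ} :
    Translate (A + {c}) B ↔ Translate A B :=
  ⟨fun h => (translate_add_singleton A c).symm.trans h,
    fun h => (translate_add_singleton A c).trans h⟩

theorem Translate.card_add_eq {A B : Finset ℕ} (h : Translate A B) (E : Finset ℕ) :
    (A + E).card = (B + E).card := by
  obtain ⟨c, c', h⟩ := h
  rw [← card_add_singleton (A + E) c, ← card_add_singleton (B + E) c', add_right_comm, h,
    add_right_comm]

theorem Translate.card_eq {A B : Finset ℕ} (h : Translate A B) : A.card = B.card := by
  simpa using h.card_add_eq {0}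

theorem mem_add_singleton {A : Finset ℕ} {c x : ℕ} : x ∈ A + {c} ↔ ∃ a ∈ A, a + c = x := by
  simp [mem_add]

theorem add_mem_add_singleton {A : Finset ℕ} {c x : ℕ} : x + c ∈ A + {c} ↔ x ∈ A := by
  simp [mem_add_singleton]

theorem erase_add_singleton (A : Finset ℕ) (b c : ℕ) :
    (A + {c}).erase (b + c) = A.erase b + {c} := by
  ext x
  simp only [mem_erase, mem_add_singleton]
  constructor
  · rintro ⟨hne, a, ha, rfl⟩
    exact ⟨a, ⟨by omega, ha⟩, rfl⟩
  · rintro ⟨a, ⟨hne, ha⟩, rfl⟩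
    exact ⟨by omega, a, ha, rfl⟩

/-! ### Arithmetic progressions and periodic sets. -/

/-- A finite set with at least two elements that is an arithmetic progression. -/
def IsAP (A : Finset ℕ) : Prop :=
  2 ≤ A.card ∧ ∃ a d : ℕ, 0 < d ∧ A = (range A.card).image (fun i => a + d * i)

theorem affine_injective (a : ℕ) {d : ℕ} (hd : 0 < d) :
    Function.Injective (fun i => a + d * i) := by
  intro i j h
  simp only [Nat.add_left_cancel_iff] at h
  exact Nat.eq_of_mul_eq_mul_left hd h

theorem isAP_image_range {m a d : ℕ} (hm : 2 ≤ m) (hd : 0 < d) :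
    IsAP ((range m).image (fun i => a + d * i)) := by
  have hc : ((range m).image (fun i => a + d * i)).card = m := by
    rw [card_image_of_injective _ (affine_injective a hd), card_range]
  exact ⟨by omega, a, d, hd, by rw [hc]⟩

theorem isAP_of_card_eq_two {A : Finset ℕ} (h : A.card = 2) : IsAP A := by
  obtain ⟨x, y, hne, rfl⟩ := card_eq_two.1 h
  wlog hxy : x < y generalizing x y
  · rw [pair_comm]
    exact this y x hne.symm (by rw [pair_comm]; exact h) (by omega)
  have h2 : ({x, y} : Finset ℕ) = (range 2).image (fun i => x + (y - x) * i) := by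
    ext z
    simp [range_add_one]
    omega
  rw [h2]
  exact isAP_image_range le_rfl (by omega)

theorem zipWith_sub_map_range (a d m : ℕ) :
    List.zipWith (fun x y => y - x) ((List.range (m + 1)).map (fun i => a + d * i))
      ((List.range (m + 1)).map (fun i => a + d * i)).tail = List.replicate m d := by
  apply List.ext_getElem
  · simp
  · intro i h1 h2
    simp [mul_add]
    omega

theorem eq_map_range_of_zipWith_sub {d : ℕ} (hd : 0 < d) (x : ℕ) (l : List ℕ)
    (h : List.zipWith (fun x y => y - x) (x :: l) l = List.replicate l.length d) :
    x :: l = (List.range (l.length + 1)).map (fun i => x + d * i) := by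
  induction l generalizing x with
  | nil => simp
  | cons y l ih =>
    simp only [List.zipWith_cons_cons, List.length_cons, List.replicate_succ, List.cons.injEq] at h
    rw [List.length_cons, ih y h.2, List.range_succ_eq_map (n := l.length + 1)]
    simp only [List.map_cons, List.map_map, Nat.mul_zero, Nat.add_zero, List.cons.injEq, true_and]
    apply List.map_congr_left
    intro i _
    simp [mul_add]
    omega

theorem periodic_iff_isAP (A : Finset ℕ) : Periodic A ↔ IsAP A := by
  unfold Periodic IsAP consecDiffs
  refine and_congr_right fun hA => ?_
  constructor
  · rintro ⟨d, hd, h⟩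
    have hlen : (A.sort (· ≤ ·)).length = A.card := length_sort _
    rcases hl : A.sort (· ≤ ·) with _ | ⟨x, l⟩
    · rw [hl] at hlen
      simp at hlen
      omega
    · rw [hl] at h hlen
      simp only [List.length_cons] at hlen
      have h' := eq_map_range_of_zipWith_sub hd x l (by simpa [← hlen] using h)
      refine ⟨x, d, hd, ?_⟩
      ext z
      rw [← mem_sort (· ≤ ·), hl, h', ← hlen]
      simp
  · rintro ⟨a, d, hd, h⟩
    refine ⟨d, hd, ?_⟩
    have hs : A.sort (· ≤ ·) = (List.range A.card).map (fun i => a + d * i) := by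
      have hsorted : ((List.range A.card).map (fun i => a + d * i)).Pairwise (· ≤ ·) := by
        rw [List.pairwise_map]
        exact List.pairwise_lt_range.imp fun hab => by gcongr
      have hnd : ((List.range A.card).map (fun i => a + d * i)).Nodup :=
        List.nodup_range.map (affine_injective a hd)
      rw [← (List.toFinset_sort (· ≤ ·) hnd).2 hsorted]
      congr 1
    obtain ⟨m, hm⟩ : ∃ m, A.card = m + 1 := ⟨A.card - 1, by omega⟩
    rw [hs, hm]
    exact zipWith_sub_map_range a d m

/-! ### Deletions of one element that agree up to translation. -/

/-- `a` is a minimum or a maximum of `A`. -/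
def IsEnd (a : ℕ) (A : Finset ℕ) : Prop := (∀ x ∈ A, a ≤ x) ∨ (∀ x ∈ A, x ≤ a)

theorem isAP_of_erase_eq_erase_add {A : Finset ℕ} {a b d : ℕ} (ha : a ∈ A) (hb : b ∈ A)
    (hab : a ≠ b) (hd : 0 < d) (h : A.erase a = A.erase b + {d}) :
    IsAP A ∧ (∀ x ∈ A, a ≤ x) ∧ (∀ x ∈ A, x ≤ b) := by
  have hup : ∀ x ∈ A, x ≠ b → x + d ∈ A := by
    intro x hx hxb
    have : x + d ∈ A.erase b + {d} := add_mem_add_singleton.2 (mem_erase.2 ⟨hxb, hx⟩)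
    rw [← h] at this
    exact mem_of_mem_erase this
  have hdown : ∀ x ∈ A, x ≠ a → ∃ y ∈ A, y + d = x := by
    intro x hx hxa
    have : x ∈ A.erase a := mem_erase.2 ⟨hxa, hx⟩
    rw [h, mem_add_singleton] at this
    obtain ⟨y, hy, hyx⟩ := this
    exact ⟨y, mem_of_mem_erase hy, hyx⟩
  -- Descending from `x` by steps of `d` stays in `A` and can stop only at `a`. The terms passed on
  -- the way are recorded, so that the descent from `b` shows that no term is missing.
  have hform : ∀ x, x ∈ A → ∃ i, x = a + d * i ∧ ∀ k ≤ i, a + d * k ∈ A := by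
    intro x
    induction x using Nat.strong_induction_on with
    | _ x ih =>
      intro hx
      by_cases hxa : x = a
      · exact ⟨0, by simpa using hxa, fun k hk => by simpa [Nat.le_zero.1 hk] using ha⟩
      · obtain ⟨y, hy, hyx⟩ := hdown x hx hxa
        obtain ⟨i, hi, hk⟩ := ih y (by omega) hy
        refine ⟨i + 1, by rw [mul_add]; omega, fun k hki => ?_⟩
        rcases Nat.lt_or_ge i k with h1 | h1
        · obtain rfl : k = i + 1 := by omega
          rw [show a + d * (i + 1) = x by rw [mul_add]; omega]
          exact hx
        · exact hk k h1
  have hmin : ∀ x ∈ A, a ≤ x := by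
    intro x hx
    obtain ⟨i, rfl, -⟩ := hform x hx
    omega
  have hne : A.Nonempty := ⟨a, ha⟩
  -- Every element other than `b` has a larger one, its shift by `d`, in `A`.
  have hmaxb : A.max' hne = b := by
    by_contra hcon
    have := A.le_max' _ (hup _ (A.max'_mem hne) hcon)
    omega
  have hmax : ∀ x ∈ A, x ≤ b := fun x hx => hmaxb ▸ A.le_max' x hx
  obtain ⟨K, hK, hKA⟩ := hform b hb
  have hA : A = (range (K + 1)).image (fun i => a + d * i) := by
    ext x
    simp only [mem_image, mem_range]
    constructor
    · intro hx
      obtain ⟨i, hi, -⟩ := hform x hx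
      refine ⟨i, ?_, hi.symm⟩
      have := hmax x hx
      rw [hi, hK] at this
      have := Nat.le_of_mul_le_mul_left (Nat.le_of_add_le_add_left this) hd
      omega
    · rintro ⟨i, hi, rfl⟩
      exact hKA i (by omega)
  refine ⟨?_, hmin, hmax⟩
  have : K ≠ 0 := by
    rintro rfl
    omega
  rw [hA]
  exact isAP_image_range (by omega) hd

theorem eq_erase_add_of_add_eq {A B : Finset ℕ} {c c' : ℕ} (hc : c ≤ c')
    (h : A + {c} = B + {c'}) : A = B + {c' - c} := by
  ext x
  rw [← add_mem_add_singleton (c := c), h, mem_add_singleton, mem_add_singleton]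
  refine exists_congr fun y => and_congr_right fun _ => ?_
  omega

/-- The sign of the shift decides which of `a`, `b` is the minimum; a zero shift would force `a =
b`. -/
theorem isAP_of_translate_erase {A : Finset ℕ} {a b : ℕ} (ha : a ∈ A) (hb : b ∈ A) (hab : a ≠ b)
    (h : Translate (A.erase a) (A.erase b)) :
    IsAP A ∧ (((∀ x ∈ A, a ≤ x) ∧ (∀ x ∈ A, x ≤ b)) ∨ ((∀ x ∈ A, b ≤ x) ∧ (∀ x ∈ A, x ≤ a))) := by
  obtain ⟨c, c', h⟩ := h
  rcases lt_trichotomy c c' with hc | rfl | hc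
  · have := isAP_of_erase_eq_erase_add ha hb hab (by omega) (eq_erase_add_of_add_eq hc.le h)
    exact ⟨this.1, Or.inl this.2⟩
  · have h' := eq_erase_add_of_add_eq le_rfl h
    rw [Nat.sub_self, show ({0} : Finset ℕ) = 0 from rfl, add_zero] at h'
    have : b ∈ A.erase a := mem_erase.2 ⟨hab.symm, hb⟩
    rw [h'] at this
    exact absurd rfl (mem_erase.1 this).1
  · have := isAP_of_erase_eq_erase_add hb ha hab.symm (by omega)
      (eq_erase_add_of_add_eq hc.le h.symm)
    exact ⟨this.1, Or.inr this.2⟩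

theorem IsAP.translate_erase {A : Finset ℕ} (hA : IsAP A) {a b : ℕ} (ha : a ∈ A) (hb : b ∈ A)
    (hamin : ∀ x ∈ A, a ≤ x) (hbmax : ∀ x ∈ A, x ≤ b) :
    a ≠ b ∧ Translate (A.erase a) (A.erase b) := by
  obtain ⟨hm, a₀, d, hd, h⟩ := hA
  set m := A.card
  have hmem : ∀ x, x ∈ A ↔ ∃ i < m, a₀ + d * i = x := fun x => by rw [h]; simp
  have h0 : a = a₀ := by
    have h1 := hamin a₀ ((hmem _).2 ⟨0, by omega, by simp⟩)
    obtain ⟨i, -, hi⟩ := (hmem a).1 ha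
    omega
  have h1 : b = a₀ + d * (m - 1) := by
    have h1 := hbmax _ ((hmem _).2 ⟨m - 1, by omega, rfl⟩)
    obtain ⟨i, him, hi⟩ := (hmem b).1 hb
    have : d * i ≤ d * (m - 1) := Nat.mul_le_mul_left d (by omega)
    omega
  subst h0
  have hmd : 0 < d * (m - 1) := Nat.mul_pos hd (by omega)
  refine ⟨by omega, 0, d, ?_⟩
  ext x
  simp only [mem_add_singleton, mem_erase, hmem, add_zero]
  constructor
  · rintro ⟨_, ⟨hne, i, hi, rfl⟩, rfl⟩
    have hi0 : i ≠ 0 := by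
      rintro rfl
      simp at hne
    obtain ⟨k, rfl⟩ : ∃ k, i = k + 1 := ⟨i - 1, by omega⟩
    refine ⟨a + d * k, ⟨?_, k, by omega, rfl⟩, by rw [mul_add]; omega⟩
    rw [h1]
    intro hcon
    have := affine_injective a hd hcon
    omega
  · rintro ⟨_, ⟨hne, i, hi, rfl⟩, rfl⟩
    have him : i ≠ m - 1 := by
      rintro rfl
      exact hne h1.symm
    exact ⟨a + d * (i + 1), ⟨by rw [mul_add]; omega, i + 1, by omega, rfl⟩, by rw [mul_add]; omega⟩

-- Besides `a` itself, only the opposite end of a progression can be deleted with the same result up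
-- to translation. This is the source of the powers of 2.
open Classical in
theorem card_filter_translate_erase {A : Finset ℕ} {a : ℕ} (ha : a ∈ A) :
    (A.filter fun b => Translate (A.erase b) (A.erase a)).card =
      if IsAP A ∧ IsEnd a A then 2 else 1 := by
  split_ifs with hcond
  · obtain ⟨hA, hend⟩ := hcond
    have hne : A.Nonempty := ⟨a, ha⟩
    obtain ⟨hlt, htr⟩ := hA.translate_erase (A.min'_mem hne) (A.max'_mem hne)
      (fun x hx => A.min'_le x hx) (fun x hx => A.le_max' x hx)
    have hae : a = A.min' hne ∨ a = A.max' hne := by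
      rcases hend with h | h
      · exact Or.inl (le_antisymm (h _ (A.min'_mem hne)) (A.min'_le a ha))
      · exact Or.inr (le_antisymm (A.le_max' a ha) (h _ (A.max'_mem hne)))
    rw [show (A.filter fun b => Translate (A.erase b) (A.erase a)) = {A.min' hne, A.max' hne} from ?_,
      card_pair hlt]
    ext b
    simp only [mem_filter, mem_insert, mem_singleton]
    constructor
    · rintro ⟨hb, htb⟩
      by_cases hba : b = a
      · rwa [hba]
      · rcases (isAP_of_translate_erase hb ha hba htb).2 with ⟨h, -⟩ | ⟨-, h⟩
        · exact Or.inl (le_antisymm (h _ (A.min'_mem hne)) (A.min'_le b hb))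
        · exact Or.inr (le_antisymm (A.le_max' b hb) (h _ (A.max'_mem hne)))
    · rintro (rfl | rfl)
      · refine ⟨A.min'_mem hne, ?_⟩
        rcases hae with h | h <;> rw [h]
        exacts [Translate.refl _, htr]
      · refine ⟨A.max'_mem hne, ?_⟩
        rcases hae with h | h <;> rw [h]
        exacts [htr.symm, Translate.refl _]
  · rw [card_eq_one]
    refine ⟨a, ?_⟩
    ext b
    simp only [mem_filter, mem_singleton]
    constructor
    · rintro ⟨hb, htb⟩
      by_contra hba
      obtain ⟨hA, h⟩ := isAP_of_translate_erase hb ha hba htb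
      exact hcond ⟨hA, h.elim (fun h => Or.inr h.2) (fun h => Or.inl h.1)⟩
    · rintro rfl
      exact ⟨ha, Translate.refl _⟩

open Classical in
theorem card_filter_translate_erase_of_translate {A B : Finset ℕ} {a : ℕ} (ha : a ∈ A)
    (hAB : Translate A B) :
    (B.filter fun b => Translate (B.erase b) (A.erase a)).card =
      if IsAP A ∧ IsEnd a A then 2 else 1 := by
  rw [← card_filter_translate_erase ha]
  have key : ∀ (C : Finset ℕ) (c : ℕ),
      ((C + {c}).filter fun b => Translate ((C + {c}).erase b) (A.erase a)).card =
        (C.filter fun b => Translate (C.erase b) (A.erase a)).card := by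
    intro C c
    rw [← card_add_singleton (C.filter fun b => Translate (C.erase b) (A.erase a)) c]
    congr 1
    ext x
    simp only [mem_filter, mem_add_singleton]
    constructor
    · rintro ⟨⟨b, hb, rfl⟩, h⟩
      rw [erase_add_singleton, translate_add_singleton_iff] at h
      exact ⟨b, ⟨hb, h⟩, rfl⟩
    · rintro ⟨b, ⟨hb, h⟩, rfl⟩
      rw [erase_add_singleton, translate_add_singleton_iff]
      exact ⟨⟨b, hb, rfl⟩, h⟩
  obtain ⟨c, c', h⟩ := hAB
  rw [← key B c', ← h, key]

/-! ### Orderings of a set and the size of a suffix-translate class. -/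

/-- The lists without repetition whose set of entries is `A`. -/
def orderings (A : Finset ℕ) : Finset (List ℕ) :=
  A.val.lists.toFinset

theorem mem_orderings {A : Finset ℕ} {l : List ℕ} :
    l ∈ orderings A ↔ l.Nodup ∧ l.toFinset = A := by
  rw [orderings, Multiset.mem_toFinset, Multiset.mem_lists_iff]
  constructor
  · intro h
    have hnd : l.Nodup := by
      have := A.nodup
      rw [h] at this
      simpa using this
    refine ⟨hnd, ?_⟩
    ext x
    rw [List.mem_toFinset, ← mem_val, h]
    simp
  · rintro ⟨hnd, rfl⟩
    simp [hnd.dedup]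

theorem length_of_mem_orderings {A : Finset ℕ} {l : List ℕ} (h : l ∈ orderings A) :
    l.length = A.card := by
  obtain ⟨hnd, rfl⟩ := mem_orderings.1 h
  exact (List.toFinset_card_of_nodup hnd).symm

theorem cons_mem_orderings {A : Finset ℕ} {a : ℕ} {l : List ℕ} :
    a :: l ∈ orderings A ↔ a ∈ A ∧ l ∈ orderings (A.erase a) := by
  simp only [mem_orderings, List.nodup_cons, List.toFinset_cons]
  constructor
  · rintro ⟨⟨hal, hnd⟩, rfl⟩
    exact ⟨mem_insert_self _ _, hnd, by rw [erase_insert (by simpa using hal)]⟩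
  · rintro ⟨ha, hnd, h⟩
    refine ⟨⟨fun hal => ?_, hnd⟩, by rw [h, insert_erase ha]⟩
    rw [← List.mem_toFinset, h] at hal
    exact absurd rfl (mem_erase.1 hal).1

theorem orderings_empty : orderings ∅ = {[]} := by
  ext l
  rw [mem_orderings, mem_singleton, List.toFinset_eq_empty_iff]
  exact ⟨fun h => h.2, fun h => ⟨h ▸ List.nodup_nil, h⟩⟩

theorem card_filter_orderings {A : Finset ℕ} (hA : A.Nonempty) (p : List ℕ → Prop)
    [DecidablePred p] :
    ((orderings A).filter p).card =
      ∑ a ∈ A, ((orderings (A.erase a)).filter fun l => p (a :: l)).card := by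
  have : (orderings A).filter p = A.biUnion fun a =>
      ((orderings (A.erase a)).filter fun l => p (a :: l)).image (List.cons a) := by
    ext l
    simp only [mem_filter, mem_biUnion, mem_image]
    constructor
    · rintro ⟨hl, hp⟩
      rcases l with _ | ⟨a, l⟩
      · obtain ⟨-, rfl⟩ := mem_orderings.1 hl
        simp at hA
      · obtain ⟨ha, hl⟩ := cons_mem_orderings.1 hl
        exact ⟨a, ha, l, ⟨hl, hp⟩, rfl⟩
    · rintro ⟨a, ha, l, ⟨hl, hp⟩, rfl⟩
      exact ⟨cons_mem_orderings.2 ⟨ha, hl⟩, hp⟩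
  rw [this, card_biUnion]
  · exact sum_congr rfl fun a _ => card_image_of_injective _ List.cons_injective
  · intro a _ b _ hab
    rw [Function.onFun, disjoint_left]
    rintro _ h1 h2
    obtain ⟨l, -, rfl⟩ := mem_image.1 h1
    obtain ⟨l', -, h⟩ := mem_image.1 h2
    exact hab (List.cons.inj h).1.symm

/-- Two lists are related when the sets of entries of corresponding suffixes are translates. -/
def SuffixTranslate (s t : List ℕ) : Prop :=
  s.length = t.length ∧ ∀ i, Translate (s.drop i).toFinset (t.drop i).toFinset

theorem SuffixTranslate.symm {s t : List ℕ} (h : SuffixTranslate s t) : SuffixTranslate t s :=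
  ⟨h.1.symm, fun i => (h.2 i).symm⟩

theorem SuffixTranslate.translate {s t : List ℕ} (h : SuffixTranslate s t) :
    Translate s.toFinset t.toFinset := by
  simpa using h.2 0

theorem suffixTranslate_cons {a b : ℕ} {s t : List ℕ} :
    SuffixTranslate (a :: s) (b :: t) ↔
      Translate (a :: s).toFinset (b :: t).toFinset ∧ SuffixTranslate s t := by
  constructor
  · intro h
    exact ⟨h.translate, by simpa using h.1, fun i => by simpa using h.2 (i + 1)⟩
  · rintro ⟨h0, hl, h⟩
    refine ⟨by simpa using hl, fun i => ?_⟩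
    cases i with
    | zero => simpa using h0
    | succ i => simpa using h i

open Classical in
/-- The number of steps at which the list removes an end of an arithmetic progression. -/
noncomputable def endCount : List ℕ → ℕ
  | [] => 0
  | a :: l => (if IsAP (a :: l).toFinset ∧ IsEnd a (a :: l).toFinset then 1 else 0) + endCount l

-- Induction on `s`: the first entry of `t` has one or two admissible values, and each leaves the
-- same count for the tail. A general `B` is needed because after one deletion the remaining sets
-- are only translates.
open Classical in
theorem card_filter_suffixTranslate {s : List ℕ} (hs : s.Nodup) {B : Finset ℕ}
    (hB : Translate s.toFinset B) :
    ((orderings B).filter fun t => SuffixTranslate t s).card = 2 ^ endCount s := by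
  induction s generalizing B with
  | nil =>
    have : B = ∅ := by
      have := hB.card_eq
      simpa using this.symm
    subst this
    rw [orderings_empty, filter_true_of_mem]
    · simp [endCount]
    · intro t ht
      rw [mem_singleton.1 ht]
      exact ⟨rfl, fun i => Translate.refl _⟩
  | cons a s ih =>
    obtain ⟨has, hnd⟩ := List.nodup_cons.1 hs
    have hBne : B.Nonempty := by
      rw [← card_pos, ← hB.card_eq, card_pos]
      exact ⟨a, by simp⟩
    have herase : (a :: s).toFinset.erase a = s.toFinset := by
      rw [List.toFinset_cons, erase_insert (by simpa using has)]
    have hstep : ∀ b ∈ B, ((orderings (B.erase b)).filter fun t =>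
        SuffixTranslate (b :: t) (a :: s)).card =
          if Translate (B.erase b) ((a :: s).toFinset.erase a) then 2 ^ endCount s else 0 := by
      intro b hb
      rw [herase]
      split_ifs with h
      · rw [← ih hnd h.symm]
        congr 1
        refine filter_congr fun t ht => ?_
        rw [suffixTranslate_cons]
        refine and_iff_right ?_
        rw [(mem_orderings.1 (cons_mem_orderings.2 ⟨hb, ht⟩)).2]
        exact hB.symm
      · rw [card_eq_zero, filter_eq_empty_iff]
        intro t ht hcon
        refine h ?_
        rw [← (mem_orderings.1 ht).2]
        exact (suffixTranslate_cons.1 hcon).2.translate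
    rw [card_filter_orderings hBne, sum_congr rfl hstep, ← sum_filter, sum_const,
      card_filter_translate_erase_of_translate (by simp) hB, endCount, pow_add, smul_eq_mul]
    split_ifs <;> simp

/-! ### Affine invariance of `endCount`. -/

theorem isAP_image_iff {A : Finset ℕ} {a d : ℕ} (hd : 0 < d) :
    IsAP (A.image fun i => a + d * i) ↔ IsAP A := by
  have hinj := affine_injective a hd
  have hcard : (A.image fun i => a + d * i).card = A.card := card_image_of_injective _ hinj
  constructor
  · rintro ⟨h2, b, k, hk, h⟩
    rw [hcard] at h2 h
    have hmem : ∀ i < A.card, ∃ x ∈ A, a + d * x = b + k * i := fun i hi => by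
      have : b + k * i ∈ (range A.card).image fun i => b + k * i :=
        mem_image_of_mem _ (mem_range.2 hi)
      rw [← h] at this
      simpa using this
    -- The preimages of the first two terms give the start and the step of the progression `A`.
    obtain ⟨x₀, -, hx₀⟩ := hmem 0 (by omega)
    obtain ⟨x₁, -, hx₁⟩ := hmem 1 (by omega)
    have hlt : x₀ < x₁ := by
      refine Nat.lt_of_mul_lt_mul_left (a := d) ?_
      omega
    have hk' : d * (x₁ - x₀) = k := by
      rw [Nat.mul_sub]
      omega
    refine ⟨h2, x₀, x₁ - x₀, by omega, ?_⟩
    apply image_injective hinj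
    rw [h, image_image]
    refine image_congr fun i _ => ?_
    simp only [Function.comp, mul_add, ← mul_assoc, hk']
    omega
  · rintro ⟨h2, b, k, hk, h⟩
    rw [h, image_image]
    have : ((fun i => a + d * i) ∘ fun i => b + k * i) = fun i => (a + d * b) + (d * k) * i := by
      ext i
      simp only [Function.comp]
      ring
    rw [this]
    exact isAP_image_range h2 (Nat.mul_pos hd hk)

theorem isEnd_image_iff {A : Finset ℕ} {a d x : ℕ} (hd : 0 < d) :
    IsEnd (a + d * x) (A.image fun i => a + d * i) ↔ IsEnd x A := by
  simp [IsEnd, hd]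

theorem endCount_map {a d : ℕ} (hd : 0 < d) (l : List ℕ) :
    endCount (l.map fun i => a + d * i) = endCount l := by
  induction l with
  | nil => rfl
  | cons x l ih =>
    have : ((x :: l).map fun i => a + d * i).toFinset =
        (x :: l).toFinset.image fun i => a + d * i := by
      ext z
      simp
    rw [List.map_cons] at this ⊢
    rw [endCount, endCount, ih, this, isAP_image_iff hd, isEnd_image_iff hd]

theorem orderings_image {f : ℕ → ℕ} (hf : Function.Injective f) (A : Finset ℕ) :
    orderings (A.image f) = (orderings A).image (List.map f) := by
  ext l
  simp only [mem_image, mem_orderings]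
  constructor
  · rintro ⟨hnd, h⟩
    have : l ∈ Set.range (List.map f) := by
      rw [Set.range_list_map]
      intro x hx
      rw [← List.mem_toFinset, h] at hx
      obtain ⟨y, -, rfl⟩ := mem_image.1 hx
      exact ⟨y, rfl⟩
    obtain ⟨l, rfl⟩ := this
    refine ⟨l, ⟨hnd.of_map f, image_injective hf ?_⟩, rfl⟩
    rw [← h]
    ext z
    simp
  · rintro ⟨l, ⟨hnd, rfl⟩, rfl⟩
    refine ⟨hnd.map hf, ?_⟩
    ext z
    simp

/-- The number of orderings of `A` with given `endCount`. -/
noncomputable def endCountCard (A : Finset ℕ) (j : ℕ) : ℕ :=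
  ((orderings A).filter fun l => endCount l = j).card

theorem endCountCard_image {a d : ℕ} (hd : 0 < d) (A : Finset ℕ) (j : ℕ) :
    endCountCard (A.image fun i => a + d * i) j = endCountCard A j := by
  have hinj := affine_injective a hd
  rw [endCountCard, endCountCard, orderings_image hinj, filter_image,
    card_image_of_injective _ (List.map_injective_iff.2 hinj)]
  simp only [endCount_map hd]

theorem Icc_eq_image_range (a m : ℕ) : Icc a m = (range (m + 1 - a)).image fun i => a + 1 * i := by
  ext x
  simp only [mem_Icc, mem_image, mem_range]
  constructor
  · rintro ⟨h1, h2⟩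
    exact ⟨x - a, by omega, by omega⟩
  · rintro ⟨i, hi, rfl⟩
    omega

theorem IsAP.endCountCard_eq {A : Finset ℕ} (hA : IsAP A) (j : ℕ) :
    endCountCard A j = endCountCard (Icc 1 A.card) j := by
  obtain ⟨-, a, d, hd, h⟩ := hA
  rw [h, endCountCard_image hd, ← h, Icc_eq_image_range, endCountCard_image one_pos]
  rfl

theorem isAP_Icc {a m : ℕ} (h : a < m) : IsAP (Icc a m) := by
  rw [Icc_eq_image_range]
  exact isAP_image_range (by omega) one_pos

/-- The last entry never counts, since a singleton is not an `IsAP`. -/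
theorem endCount_lt_length {l : List ℕ} (hl : l ≠ []) : endCount l < l.length := by
  induction l with
  | nil => exact absurd rfl hl
  | cons a l ih =>
    rw [endCount]
    by_cases h : l = []
    · subst h
      rw [if_neg]
      · simp [endCount]
      · rintro ⟨⟨h2, -⟩, -⟩
        simp at h2
    · have := ih h
      rw [List.length_cons]
      split_ifs <;> omega

theorem endCountCard_eq_zero {A : Finset ℕ} (hA : A.Nonempty) {j : ℕ} (hj : A.card ≤ j) :
    endCountCard A j = 0 := by
  rw [endCountCard, card_eq_zero, filter_eq_empty_iff]
  rintro l hl rfl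
  have hlen := length_of_mem_orderings hl
  have : l ≠ [] := by
    rintro rfl
    have := card_pos.2 hA
    simp at hlen
    omega
  have := endCount_lt_length this
  omega

/-! ### First returns to a progression and the recurrence. -/

theorem not_isAP_Icc_erase {n a : ℕ} (hn : 4 ≤ n) (h1 : 1 < a) (han : a < n) :
    ¬ IsAP ((Icc 1 n).erase a) := by
  rintro ⟨-, b, d, hd, h⟩
  have hcard : ((Icc 1 n).erase a).card = n - 1 := by
    rw [card_erase_of_mem (mem_Icc.2 ⟨h1.le, han.le⟩)]
    simp
  rw [hcard] at h
  have hmem : ∀ x, (x ≠ a ∧ 1 ≤ x ∧ x ≤ n) ↔ ∃ i < n - 1, b + d * i = x := fun x => by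
    have := Finset.ext_iff.1 h x
    simpa using this
  obtain ⟨i, -, hi⟩ := (hmem 1).1 (by omega)
  have hb := (hmem (b + d * 0)).2 ⟨0, by omega, rfl⟩
  have hlast := (hmem (b + d * (n - 2))).2 ⟨n - 2, by omega, rfl⟩
  obtain ⟨k, hk, hkn⟩ := (hmem n).1 (by omega)
  -- A step of at least 2 makes `n - 1` terms span at least `2 * (n - 2)`, more than `n - 1` because
  -- `n ≥ 4`; for `n = 3` the set `{1, 3}` is a counterexample. A step of 1 spans only `n - 2`, too
  -- little to reach both 1 and `n`.
  have hd1 : d = 1 := by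
    by_contra hne
    have : 2 * (n - 2) ≤ d * (n - 2) := Nat.mul_le_mul_right _ (by omega)
    omega
  subst hd1
  omega

theorem toFinset_drop {A : Finset ℕ} {l : List ℕ} (hl : l ∈ orderings A) (k : ℕ) :
    (l.drop k).toFinset = A \ (l.take k).toFinset := by
  obtain ⟨hnd, rfl⟩ := mem_orderings.1 hl
  rw [← List.take_append_drop k l] at hnd
  have hdis := (List.nodup_append'.1 hnd).2.2
  ext x
  conv_rhs => rw [← List.take_append_drop k l, List.toFinset_append]
  simp only [mem_sdiff, mem_union, List.mem_toFinset, List.take_append_drop]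
  constructor
  · intro hx
    exact ⟨Or.inr hx, fun hx' => hdis hx' hx⟩
  · rintro ⟨h | h, h'⟩
    · exact absurd h h'
    · exact h

theorem append_mem_orderings {A : Finset ℕ} {p r r' : List ℕ} (h : p ++ r' ∈ orderings A) :
    p ++ r ∈ orderings A ↔ r ∈ orderings (A \ p.toFinset) := by
  constructor
  · intro hr
    have := toFinset_drop hr p.length
    rw [List.drop_left, List.take_left] at this
    exact mem_orderings.2 ⟨(List.nodup_append'.1 (mem_orderings.1 hr).1).2.1, this⟩
  · intro hr
    obtain ⟨hnd, hrA⟩ := mem_orderings.1 hr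
    obtain ⟨hnd', hA⟩ := mem_orderings.1 h
    refine mem_orderings.2 ⟨List.nodup_append'.2
      ⟨(List.nodup_append'.1 hnd').1, hnd, fun x hx hx' => ?_⟩, ?_⟩
    · rw [← List.mem_toFinset, hrA] at hx'
      exact (mem_sdiff.1 hx').2 (List.mem_toFinset.2 hx)
    · rw [List.toFinset_append, hrA, union_sdiff_of_subset]
      rw [← hA, List.toFinset_append]
      exact subset_union_left

theorem endCount_drop (l : List ℕ) (k : ℕ) (h : ∀ i < k, ¬ IsAP (l.drop i).toFinset) :
    endCount l = endCount (l.drop k) := by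
  induction k generalizing l with
  | zero => rfl
  | succ k ih =>
    cases l with
    | nil => rfl
    | cons a l =>
      rw [List.drop_succ_cons, ← ih l fun i hi => by simpa using h (i + 1) (by omega), endCount,
        if_neg fun hc => h 0 (by omega) hc.1, zero_add]

/-- Removing the list `p` of length `k` from `{1, …, n}` leaves an arithmetic progression, while
removing a shorter nonempty prefix of `p` does not. -/
def IsFirstReturn (k n : ℕ) (p : List ℕ) : Prop :=
  p.length = k ∧ IsAP (Icc 1 n \ p.toFinset) ∧
    ∀ i, 1 ≤ i → i < k → ¬ IsAP (Icc 1 n \ (p.take i).toFinset)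

open Classical in
/-- The prefixes `p` of orderings of `{1, …, n}` with `IsFirstReturn k n p`. -/
noncomputable def firstReturn (k n : ℕ) : Finset (List ℕ) :=
  ((orderings (Icc 1 n)).image (List.take k)).filter (IsFirstReturn k n)

theorem mem_firstReturn {k n : ℕ} {p : List ℕ} :
    p ∈ firstReturn k n ↔ (∃ l ∈ orderings (Icc 1 n), l.take k = p) ∧ IsFirstReturn k n p := by
  simp only [firstReturn, mem_filter, mem_image]

theorem isFirstReturn_of_mem_firstReturn {k n : ℕ} {p : List ℕ} (hp : p ∈ firstReturn k n) :
    IsFirstReturn k n p :=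
  (mem_firstReturn.1 hp).2

theorem length_of_mem_firstReturn {k n : ℕ} {p : List ℕ} (hp : p ∈ firstReturn k n) :
    p.length = k :=
  (isFirstReturn_of_mem_firstReturn hp).1

theorem exists_append_mem_of_mem_firstReturn {k n : ℕ} {p : List ℕ} (hp : p ∈ firstReturn k n) :
    ∃ r, p ++ r ∈ orderings (Icc 1 n) := by
  obtain ⟨l, hl, rfl⟩ := (mem_firstReturn.1 hp).1
  exact ⟨l.drop k, by rwa [List.take_append_drop]⟩

theorem card_sdiff_of_mem_firstReturn {k n : ℕ} {p : List ℕ} (hp : p ∈ firstReturn k n) :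
    (Icc 1 n \ p.toFinset).card = n - k := by
  obtain ⟨r, hr⟩ := exists_append_mem_of_mem_firstReturn hp
  have h1 := length_of_mem_orderings ((append_mem_orderings hr).1 hr)
  have h2 := length_of_mem_orderings hr
  rw [List.length_append, length_of_mem_firstReturn hp] at h2
  simp at h2
  omega

/-- If `k < k'`, then `p` would be a proper prefix of `p'` that already leaves a progression. So an
ordering has at most one first return, which makes the unions below disjoint. -/
theorem firstReturn_prefix_free {k k' n : ℕ} {p p' r r' : List ℕ} (hk : 1 ≤ k)
    (hp : p ∈ firstReturn k n) (hp' : p' ∈ firstReturn k' n) (h : p ++ r = p' ++ r') :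
    k' ≤ k := by
  by_contra hlt
  refine (isFirstReturn_of_mem_firstReturn hp').2.2 k hk (by omega) ?_
  have : p'.take k = p := by
    have hl := length_of_mem_firstReturn hp
    have hl' := length_of_mem_firstReturn hp'
    have := congrArg (List.take k) h
    rw [List.take_append_of_le_length (by omega), List.take_append_of_le_length (by omega),
      List.take_of_length_le (by omega)] at this
    exact this.symm
  rw [this]
  exact (isFirstReturn_of_mem_firstReturn hp).2.1

theorem Icc_erase_left (n : ℕ) : (Icc 1 n).erase 1 = Icc 2 n := by
  ext x
  simp only [mem_erase, mem_Icc]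
  omega

theorem Icc_erase_right {n : ℕ} : (Icc 1 n).erase n = Icc 1 (n - 1) := by
  ext x
  simp only [mem_erase, mem_Icc]
  omega

open Classical in
theorem mem_biUnion_firstReturn_iff {n j : ℕ} (hn : 4 ≤ n) (l : List ℕ) :
    (l ∈ orderings (Icc 1 n) ∧ endCount l = j ∧ 1 < l.headI ∧ l.headI < n) ↔
      ∃ k ∈ Icc 2 (n - 2), ∃ p ∈ firstReturn k n, ∃ r ∈ orderings (Icc 1 n \ p.toFinset),
        endCount r = j ∧ p ++ r = l := by
  constructor
  · rintro ⟨hl, hj, h1, h2⟩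
    have hlen : l.length = n := by simpa using length_of_mem_orderings hl
    obtain ⟨a, l, rfl⟩ := List.exists_cons_of_length_pos (by omega : 0 < l.length)
    simp only [List.headI_cons] at h1 h2
    -- A return always occurs, since two remaining elements form a progression; the least such `k`
    -- is used.
    have hex : ∃ k, 1 ≤ k ∧ IsAP ((a :: l).drop k).toFinset := by
      refine ⟨n - 2, by omega, isAP_of_card_eq_two ?_⟩
      rw [List.toFinset_card_of_nodup ((mem_orderings.1 hl).1.sublist (List.drop_sublist _ _)), List.length_drop]
      omega
    obtain ⟨hk1, hkAP⟩ := Nat.find_spec hex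
    have hkmin : ∀ i < Nat.find hex, 1 ≤ i → ¬ IsAP ((a :: l).drop i).toFinset :=
      fun i hi h1 h => Nat.find_min hex hi ⟨h1, h⟩
    set k := Nat.find hex
    have hdrop1 : ((a :: l).drop 1).toFinset = (Icc 1 n).erase a := by
      rw [List.drop_one, List.tail_cons]
      exact (mem_orderings.1 (cons_mem_orderings.1 hl).2).2
    have hkne : k ≠ 1 := by
      intro h
      rw [h, hdrop1] at hkAP
      exact not_isAP_Icc_erase hn h1 h2 hkAP
    have hkn : k ≤ n - 2 := by
      have := hkAP.1
      rw [List.toFinset_card_of_nodup ((mem_orderings.1 hl).1.sublist (List.drop_sublist _ _)), List.length_drop]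
        at this
      omega
    have hl' : (a :: l).take k ++ (a :: l).drop k ∈ orderings (Icc 1 n) := by
      rwa [List.take_append_drop]
    refine ⟨k, mem_Icc.2 ⟨by omega, hkn⟩, (a :: l).take k, ?_, (a :: l).drop k,
      (append_mem_orderings hl').1 hl', ?_, List.take_append_drop _ _⟩
    · refine mem_firstReturn.2 ⟨⟨_, hl, rfl⟩, by rw [List.length_take]; omega, ?_, ?_⟩
      · rwa [← toFinset_drop hl]
      · intro i hi hik
        rw [List.take_take, min_eq_left hik.le, ← toFinset_drop hl]
        exact hkmin i hik hi
    · rw [← hj, endCount, if_neg, zero_add]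
      · obtain ⟨m, hm⟩ : ∃ m, k = m + 1 := ⟨k - 1, by omega⟩
        rw [hm, List.drop_succ_cons]
        refine (endCount_drop l m fun i hi => ?_).symm
        simpa using hkmin (i + 1) (by omega) (by omega)
      · rw [(mem_orderings.1 hl).2]
        rintro ⟨-, h | h⟩
        · have := h 1 (mem_Icc.2 (by omega))
          omega
        · have := h n (mem_Icc.2 (by omega))
          omega
  · rintro ⟨k, hk, p, hp, r, hr, hj, rfl⟩
    obtain ⟨r', hr'⟩ := exists_append_mem_of_mem_firstReturn hp
    have hl := (append_mem_orderings hr').2 hr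
    have hplen := length_of_mem_firstReturn hp
    obtain ⟨hk2, hkn⟩ := mem_Icc.1 hk
    obtain ⟨-, -, hmin⟩ := isFirstReturn_of_mem_firstReturn hp
    obtain ⟨a, q, rfl⟩ := List.exists_cons_of_length_pos (by omega : 0 < p.length)
    have ha : a ∈ Icc 1 n := (cons_mem_orderings.1 hl).1
    obtain ⟨ha1, han⟩ := mem_Icc.1 ha
    -- As `k ≥ 2`, the prefix of length 1 leaves no progression, which excludes the ends 1 and `n`
    -- as first entry.
    have hnot : ¬ IsAP ((Icc 1 n).erase a) := by
      have := hmin 1 le_rfl (by omega)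
      rwa [← sdiff_singleton_eq_erase]
    have hane1 : a ≠ 1 := by
      rintro rfl
      rw [Icc_erase_left] at hnot
      exact hnot (isAP_Icc (by omega))
    have hanen : a ≠ n := by
      rintro rfl
      rw [Icc_erase_right] at hnot
      exact hnot (isAP_Icc (by omega))
    refine ⟨hl, ?_, ?_, ?_⟩
    · rw [List.cons_append, endCount, if_neg, zero_add, endCount_drop (q ++ r) q.length,
        List.drop_left, hj]
      · intro i hi
        have hd : (q ++ r).drop i = (a :: q ++ r).drop (i + 1) := by simp
        rw [hd, toFinset_drop hl, List.take_append_of_le_length (by simp; omega)]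
        exact hmin (i + 1) (by omega) (by simp at hplen; omega)
      · rw [← List.cons_append, (mem_orderings.1 hl).2]
        rintro ⟨-, h | h⟩
        · have := h 1 (mem_Icc.2 (by omega))
          omega
        · have := h n (mem_Icc.2 (by omega))
          omega
    · simp
      omega
    · simp
      omega

theorem card_filter_interior {n : ℕ} (hn : 4 ≤ n) (j : ℕ) :
    ((orderings (Icc 1 n)).filter
      fun l => endCount l = j ∧ 1 < l.headI ∧ l.headI < n).card =
      ∑ k ∈ Icc 2 (n - 2), (firstReturn k n).card * endCountCard (Icc 1 (n - k)) j := by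
  have h : (orderings (Icc 1 n)).filter (fun l => endCount l = j ∧ 1 < l.headI ∧ l.headI < n) =
      (Icc 2 (n - 2)).biUnion fun k => (firstReturn k n).biUnion fun p =>
        ((orderings (Icc 1 n \ p.toFinset)).filter fun r => endCount r = j).image (p ++ ·) := by
    ext l
    rw [mem_filter, mem_biUnion_firstReturn_iff hn]
    simp only [mem_biUnion, mem_image, mem_filter, and_assoc]
  rw [h, card_biUnion]
  · refine sum_congr rfl fun k hk => ?_
    rw [card_biUnion]
    · rw [← smul_eq_mul, ← sum_const]
      refine sum_congr rfl fun p hp => ?_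
      rw [card_image_of_injective _ (List.append_right_injective p),
        ← card_sdiff_of_mem_firstReturn hp, ← IsAP.endCountCard_eq (isFirstReturn_of_mem_firstReturn hp).2.1]
      rfl
    · intro p hp p' hp' hne
      rw [Function.onFun, disjoint_left]
      intro l h1 h2
      obtain ⟨r, -, rfl⟩ := mem_image.1 h1
      obtain ⟨r', -, h⟩ := mem_image.1 h2
      refine hne (List.append_inj h ?_).1.symm
      rw [length_of_mem_firstReturn hp, length_of_mem_firstReturn hp']
  · intro k hk k' hk' hne
    rw [Function.onFun, disjoint_left]
    intro l h1 h2
    simp only [mem_biUnion, mem_image] at h1 h2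
    obtain ⟨p, hp, r, -, rfl⟩ := h1
    obtain ⟨p', hp', r', -, h⟩ := h2
    have hk := (mem_Icc.1 hk).1
    have hk' := (mem_Icc.1 hk').1
    exact hne (le_antisymm (firstReturn_prefix_free (by omega) hp' hp h)
      (firstReturn_prefix_free (by omega) hp hp' h.symm))

theorem card_filter_not_interior {n j : ℕ} (hn : 3 ≤ n) (hj : 1 ≤ j) :
    ((orderings (Icc 1 n)).filter
      fun l => endCount l = j ∧ ¬ (1 < l.headI ∧ l.headI < n)).card =
      2 * endCountCard (Icc 1 (n - 1)) (j - 1) := by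
  rw [card_filter_orderings ⟨1, mem_Icc.2 (by omega)⟩]
  have hterm : ∀ a ∈ Icc 1 n, ((orderings ((Icc 1 n).erase a)).filter fun l =>
      endCount (a :: l) = j ∧ ¬ (1 < (a :: l).headI ∧ (a :: l).headI < n)).card =
        if a ∈ ({1, n} : Finset ℕ) then endCountCard (Icc 1 (n - 1)) (j - 1) else 0 := by
    intro a ha
    have hA := mem_Icc.1 ha
    simp only [mem_insert, mem_singleton]
    split_ifs with hend
    · have herase : IsAP ((Icc 1 n).erase a) := by
        rcases hend with rfl | rfl
        · rw [Icc_erase_left]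
          exact isAP_Icc (by omega)
        · rw [Icc_erase_right]
          exact isAP_Icc (by omega)
      have hcard : ((Icc 1 n).erase a).card = n - 1 := by
        rw [card_erase_of_mem ha]
        simp
      rw [← hcard, ← herase.endCountCard_eq, endCountCard]
      congr 1
      refine filter_congr fun l hl => ?_
      have hset := (mem_orderings.1 (cons_mem_orderings.2 ⟨ha, hl⟩)).2
      rw [endCount, hset, if_pos]
      · rw [List.headI_cons]
        omega
      · refine ⟨isAP_Icc (by omega), ?_⟩
        rcases hend with rfl | rfl
        · exact Or.inl fun x hx => (mem_Icc.1 hx).1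
        · exact Or.inr fun x hx => (mem_Icc.1 hx).2
    · rw [card_eq_zero, filter_eq_empty_iff]
      intro l _
      rw [List.headI_cons]
      omega
  rw [sum_congr rfl hterm, ← sum_filter, sum_const, smul_eq_mul]
  congr 1
  rw [filter_mem_eq_inter, inter_eq_right.2, card_pair (by omega)]
  intro x hx
  simp only [mem_insert, mem_singleton] at hx
  rw [mem_Icc]
  omega

/-- The orderings are split according to whether the first entry is an end. Terms with `k ≥ n - j`
vanish, because `endCount` stays below the number `n - k ≤ j` of remaining elements. -/
theorem endCountCard_Icc {n j : ℕ} (hn : 4 ≤ n) (hj : 1 ≤ j) :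
    endCountCard (Icc 1 n) j = 2 * endCountCard (Icc 1 (n - 1)) (j - 1) +
      ∑ k ∈ Icc 2 (n - j - 1), (firstReturn k n).card * endCountCard (Icc 1 (n - k)) j := by
  have hsum : ∑ k ∈ Icc 2 (n - j - 1), (firstReturn k n).card * endCountCard (Icc 1 (n - k)) j =
      ∑ k ∈ Icc 2 (n - 2), (firstReturn k n).card * endCountCard (Icc 1 (n - k)) j := by
    refine sum_subset (Icc_subset_Icc le_rfl (by omega)) fun k hk hk' => ?_
    rw [mem_Icc] at hk hk'
    rw [endCountCard_eq_zero ⟨1, mem_Icc.2 (by omega)⟩, mul_zero]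
    rw [Nat.card_Icc]
    omega
  rw [hsum, ← card_filter_interior hn, ← card_filter_not_interior (by omega) hj, endCountCard,
    ← card_filter_add_card_filter_not (fun l : List ℕ => 1 < l.headI ∧ l.headI < n),
    filter_filter, filter_filter, add_comm]

/-! ### Recovering sets up to translation from sums of sumset cardinalities. -/

/-- The intersection of the translates of `A` by the elements of `T`. -/
def interTranslates (A T : Finset ℕ) : Finset ℕ :=
  (A + T).filter fun x => ∀ e ∈ T, x ∈ A + {e}

theorem mem_interTranslates {A T : Finset ℕ} (hT : T.Nonempty) {x : ℕ} :
    x ∈ interTranslates A T ↔ ∀ e ∈ T, x ∈ A + {e} := by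
  rw [interTranslates, mem_filter, and_iff_right_iff_imp]
  intro h
  obtain ⟨e, he⟩ := hT
  exact add_subset_add_left (singleton_subset_iff.2 he) (h e he)

theorem card_add_eq_sum_interTranslates (A E : Finset ℕ) :
    ((A + E).card : ℤ) = ∑ T ∈ E.powerset.filter (·.Nonempty),
      (-1) ^ (T.card + 1) * ((interTranslates A T).card : ℤ) := by
  have h : A + E = E.biUnion fun e => A + {e} := by
    ext x
    simp only [mem_add, mem_biUnion, mem_singleton]
    constructor
    · rintro ⟨a, ha, e, he, rfl⟩
      exact ⟨e, he, a, ha, e, rfl, rfl⟩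
    · rintro ⟨e, he, a, ha, _, rfl, rfl⟩
      exact ⟨a, ha, _, he, rfl⟩
  rw [h, inclusion_exclusion_card_biUnion,
    ← sum_coe_sort (E.powerset.filter (·.Nonempty))
      fun T => (-1 : ℤ) ^ (T.card + 1) * ((interTranslates A T).card : ℤ)]
  refine sum_congr rfl fun T _ => ?_
  congr 3
  ext x
  rw [mem_inf', mem_interTranslates (mem_filter.1 T.2).2]

/-- Inclusion–exclusion is inverted: by induction all terms for proper subsets of `T` agree, hence
so does the term for `T`. -/
theorem sum_card_interTranslates_eq {I : Finset ℕ} {P Q : ℕ → Finset ℕ}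
    (h : ∀ E, ∑ i ∈ I, (P i + E).card = ∑ i ∈ I, (Q i + E).card) (T : Finset ℕ)
    (hT : T.Nonempty) :
    ∑ i ∈ I, (interTranslates (P i) T).card = ∑ i ∈ I, (interTranslates (Q i) T).card := by
  induction T using Finset.strongInduction with
  | _ T ih =>
    have key : ∀ R : ℕ → Finset ℕ, ((∑ i ∈ I, (R i + T).card : ℕ) : ℤ) =
        ∑ U ∈ T.powerset.filter (·.Nonempty),
          (-1) ^ (U.card + 1) * ((∑ i ∈ I, (interTranslates (R i) U).card : ℕ) : ℤ) := by
      intro R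
      push_cast
      simp_rw [card_add_eq_sum_interTranslates, mul_sum]
      exact sum_comm
    have hmem : T ∈ T.powerset.filter (·.Nonempty) := by simp [hT]
    have hP := key P
    have hQ := key Q
    rw [h T, hQ, ← add_sum_erase _ _ hmem, ← add_sum_erase _ _ hmem] at hP
    have hrest : ∀ U ∈ (T.powerset.filter (·.Nonempty)).erase T,
        (-1 : ℤ) ^ (U.card + 1) * ((∑ i ∈ I, (interTranslates (Q i) U).card : ℕ) : ℤ) =
          (-1) ^ (U.card + 1) * ((∑ i ∈ I, (interTranslates (P i) U).card : ℕ) : ℤ) := by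
      intro U hU
      obtain ⟨hne, hU⟩ := mem_erase.1 hU
      obtain ⟨hsub, hUne⟩ := mem_filter.1 hU
      rw [ih U ((mem_powerset.1 hsub).ssubset_of_ne hne) hUne]
    rw [sum_congr rfl hrest] at hP
    have := add_right_cancel hP
    have := mul_left_cancel₀ (pow_ne_zero _ (by norm_num)) this
    exact_mod_cast this.symm

/-- The levels below `i` cancel by induction. With `T` the reflection `N - P i`, the set
`interTranslates R T` indexes the translates of `P i` contained in `R + {N}`. There is one for `R =
P i`, hence one for some `R = Q k` with `k ≥ i`; cardinalities then force `k = i` and equality. -/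
theorem translate_of_sum_card_add_eq {n : ℕ} {P Q : ℕ → Finset ℕ}
    (hP : ∀ i ∈ Ico 1 (n + 1), (P i).card = n + 1 - i)
    (hQ : ∀ i ∈ Ico 1 (n + 1), (Q i).card = n + 1 - i)
    (h : ∀ E, ∑ i ∈ Ico 1 (n + 1), (P i + E).card = ∑ i ∈ Ico 1 (n + 1), (Q i + E).card)
    {i : ℕ} (hi : i ∈ Ico 1 (n + 1)) : Translate (P i) (Q i) := by
  induction i using Nat.strong_induction_on with
  | _ i ih =>
    obtain ⟨hi1, hin⟩ := mem_Ico.1 hi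
    have hrest : ∀ E, ∑ k ∈ Ico i (n + 1), (P k + E).card =
        ∑ k ∈ Ico i (n + 1), (Q k + E).card := by
      intro E
      have h1 := h E
      rw [← sum_Ico_consecutive _ hi1 hin.le, ← sum_Ico_consecutive _ hi1 hin.le,
        sum_congr rfl fun k hk => (ih k (mem_Ico.1 hk).2
          (mem_Ico.2 (by rw [mem_Ico] at hk; omega))).card_add_eq E] at h1
      exact add_left_cancel h1
    have hPne : (P i).Nonempty := by
      rw [← card_pos, hP i hi]
      omega
    obtain ⟨N, hN⟩ : ∃ N, ∀ p ∈ P i, p ≤ N := ⟨(P i).sup id, fun p hp => le_sup (f := id) hp⟩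
    have hT := sum_card_interTranslates_eq hrest ((P i).image fun p => N - p) (hPne.image _)
    have hpos : 0 < ∑ k ∈ Ico i (n + 1),
        (interTranslates (P k) ((P i).image fun p => N - p)).card := by
      refine sum_pos' (fun _ _ => Nat.zero_le _) ⟨i, mem_Ico.2 ⟨le_rfl, hin⟩, ?_⟩
      refine card_pos.2 ⟨N, (mem_interTranslates (hPne.image _)).2 fun e he => ?_⟩
      obtain ⟨p, hp, rfl⟩ := mem_image.1 he
      exact mem_add_singleton.2 ⟨p, hp, Nat.add_sub_cancel' (hN p hp)⟩
    rw [hT] at hpos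
    obtain ⟨k, hk, hkpos⟩ := (sum_pos_iff_of_nonneg fun _ _ => Nat.zero_le _).1 hpos
    obtain ⟨x, hx⟩ := card_pos.1 hkpos
    rw [mem_interTranslates (hPne.image _)] at hx
    have hsub : P i + {x} ⊆ Q k + {N} := by
      intro y hy
      obtain ⟨p, hp, rfl⟩ := mem_add_singleton.1 hy
      obtain ⟨q, hq, hqx⟩ := mem_add_singleton.1 (hx (N - p) (mem_image_of_mem _ hp))
      have := hN p hp
      exact mem_add_singleton.2 ⟨q, hq, by omega⟩
    rw [mem_Ico] at hk
    have hcard := card_le_card hsub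
    rw [card_add_singleton, card_add_singleton, hP i hi, hQ k (mem_Ico.2 (by omega))] at hcard
    obtain rfl : k = i := by omega
    refine ⟨x, N, eq_of_subset_of_card_le hsub ?_⟩
    rw [card_add_singleton, card_add_singleton, hP k hi, hQ k hi]

/-- Downward induction on `E`: the number with value containing `E` is the number with value `E`
plus those with strictly larger values, all inside the finite set `U`. -/
theorem card_filter_eq_of_card_filter_subset {α : Type*} {Ω : Finset α} {f g : α → Finset ℕ}
    (h : ∀ E, (Ω.filter fun w => E ⊆ f w).card = (Ω.filter fun w => E ⊆ g w).card)
    (E : Finset ℕ) : (Ω.filter fun w => f w = E).card = (Ω.filter fun w => g w = E).card := by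
  set U := Ω.biUnion f ∪ Ω.biUnion g with hU
  have key : ∀ (φ : α → Finset ℕ), (∀ w ∈ Ω, φ w ⊆ U) → ∀ E,
      (Ω.filter fun w => E ⊆ φ w).card = (Ω.filter fun w => φ w = E).card +
        ∑ F ∈ U.powerset.filter (E ⊂ ·), (Ω.filter fun w => φ w = F).card := by
    intro φ hφ E
    rw [← card_filter_add_card_filter_not (fun w => φ w = E), filter_filter, filter_filter]
    congr 1
    · congr 1
      refine filter_congr fun w _ => ⟨fun h => h.2, fun h => ⟨h.ge, h⟩⟩
    · rw [card_eq_sum_card_fiberwise (f := φ) (t := U.powerset.filter (E ⊂ ·))]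
      · refine sum_congr rfl fun F hF => ?_
        rw [filter_filter]
        congr 1
        have hEF := (mem_filter.1 hF).2
        refine filter_congr fun w _ => ⟨fun h => h.2, fun h => ⟨?_, h⟩⟩
        rw [h]
        exact ⟨hEF.subset, hEF.ne'⟩
      · intro w hw
        obtain ⟨hw, hsub, hne⟩ := mem_filter.1 (mem_coe.1 hw)
        exact mem_coe.2 (mem_filter.2
          ⟨mem_powerset.2 (hφ w hw), hsub.ssubset_of_ne (Ne.symm hne)⟩)
  have hf : ∀ w ∈ Ω, f w ⊆ U :=
    fun w hw => (subset_biUnion_of_mem f hw).trans subset_union_left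
  have hg : ∀ w ∈ Ω, g w ⊆ U :=
    fun w hw => (subset_biUnion_of_mem g hw).trans subset_union_right
  have main : ∀ m, ∀ E : Finset ℕ, U.card + 1 - E.card ≤ m →
      (Ω.filter fun w => f w = E).card = (Ω.filter fun w => g w = E).card := by
    intro m
    induction m with
    | zero =>
      intro E hE
      have hempty : ∀ φ : α → Finset ℕ, (∀ w ∈ Ω, φ w ⊆ U) → Ω.filter (fun w => φ w = E) = ∅ := by
        intro φ hφ
        rw [filter_eq_empty_iff]
        rintro w hw rfl
        have := card_le_card (hφ w hw)
        omega
      rw [hempty f hf, hempty g hg]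
    | succ m ih =>
      intro E hE
      have h1 := h E
      rw [key f hf, key g hg, sum_congr rfl fun F hF => ih F ?_] at h1
      · exact add_right_cancel h1
      · have := card_lt_card (mem_filter.1 hF).2
        omega
  exact main _ E le_rfl

/-! ### Letters, embeddings and minimal cluster words. -/

/-- The letter of `w` at the (0-based) position `q`, or `0` beyond the end of `w`. -/
def val (w : Word) (q : ℕ) : ℕ := (w.map fun a : ℕ+ => (a : ℕ)).getD q 0

theorem val_of_lt {w : Word} {q : ℕ} (h : q < w.length) : val w q = (w[q] : ℕ) := by
  rw [val, List.getD_eq_getElem _ _ (by simpa using h), List.getElem_map]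

theorem one_le_val {w : Word} {q : ℕ} (h : q < w.length) : 1 ≤ val w q := by
  rw [val_of_lt h]
  exact (w[q]).pos

theorem val_of_le {w : Word} {q : ℕ} (h : w.length ≤ q) : val w q = 0 := by
  rw [val, List.getD_eq_default _ _ (by simpa using h)]

theorem height_eq_sum (w : Word) : height w = ∑ q ∈ range w.length, val w q := by
  rw [height, ← Fin.sum_univ_fun_getElem, sum_range]
  exact sum_congr rfl fun q _ => (val_of_lt q.2).symm

theorem word_ext {w w' : Word} (hl : w.length = w'.length)
    (h : ∀ q < w.length, val w q = val w' q) : w = w' := by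
  refine List.ext_getElem hl fun q hq hq' => ?_
  have := h q hq
  rw [val_of_lt hq, val_of_lt hq'] at this
  exact PNat.coe_injective this

/-- The word of length `L` with letters `f 0, f 1, …`. -/
def ofVals (L : ℕ) (f : ℕ → ℕ) : Word := (List.range L).map fun q => (f q).toPNat'

@[simp] theorem length_ofVals (L : ℕ) (f : ℕ → ℕ) : (ofVals L f).length = L := by
  simp [ofVals]

theorem val_ofVals {L : ℕ} {f : ℕ → ℕ} {q : ℕ} (hq : q < L) (hf : 1 ≤ f q) :
    val (ofVals L f) q = f q := by
  rw [val_of_lt (by simpa using hq)]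
  simp [ofVals, PNat.toPNat'_coe hf]

theorem height_ofVals {L : ℕ} {f : ℕ → ℕ} (hf : ∀ q < L, 1 ≤ f q) :
    height (ofVals L f) = ∑ q ∈ range L, f q := by
  rw [height_eq_sum, length_ofVals]
  exact sum_congr rfl fun q hq => val_ofVals (mem_range.1 hq) (hf q (mem_range.1 hq))

/-- The set of (0-based) positions of the embeddings of `u` into `w`. -/
def embeddings (u w : Word) : Finset ℕ :=
  (range (w.length + 1)).filter fun p =>
    p + u.length ≤ w.length ∧ ∀ i < u.length, val u i ≤ val w (p + i)

theorem mem_embeddings {u w : Word} {p : ℕ} :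
    p ∈ embeddings u w ↔
      p + u.length ≤ w.length ∧ ∀ i < u.length, val u i ≤ val w (p + i) := by
  rw [embeddings, mem_filter, mem_range, and_iff_right_iff_imp]
  omega

theorem Em_eq_image (u w : Word) : Em u w = (· + 1) '' (embeddings u w : Set ℕ) := by
  ext j
  simp only [Em, Set.mem_ofPred_eq, Set.mem_image, mem_coe, mem_embeddings, List.forall₂_iff_get]
  constructor
  · rintro ⟨s, v, t, rfl, rfl, hlen, h⟩
    refine ⟨s.length, ⟨by simp; omega, fun i hi => ?_⟩, rfl⟩
    rw [val_of_lt hi, val_of_lt (by simp; omega)]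
    have := h i hi (by omega)
    simp only [List.get_eq_getElem] at this
    simpa [List.getElem_append, hlen ▸ hi] using this
  · rintro ⟨p, ⟨hle, h⟩, rfl⟩
    refine ⟨w.take p, (w.drop p).take u.length, (w.drop p).drop u.length, ?_, ?_, ?_, ?_⟩
    · rw [List.append_assoc, List.take_append_drop, List.take_append_drop]
    · rw [List.length_take]
      omega
    · rw [List.length_take, List.length_drop]
      omega
    · intro i hi hi'
      have := h i hi
      rw [val_of_lt hi, val_of_lt (by omega)] at this
      simpa using this

theorem Em_eq_Em_iff {u v w w' : Word} :
    Em u w = Em v w' ↔ embeddings u w = embeddings v w' := by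
  rw [Em_eq_image, Em_eq_image, (Set.image_injective.2 (add_left_injective 1)).eq_iff, coe_inj]

/-- The least letter at position `q` in a word into which `u` embeds at all positions in `E`. -/
def cluster (u : Word) (E : Finset ℕ) (q : ℕ) : ℕ :=
  max 1 (E.sup fun p => if p ≤ q then val u (q - p) else 0)

theorem one_le_cluster (u : Word) (E : Finset ℕ) (q : ℕ) : 1 ≤ cluster u E q := le_max_left _ _

theorem subset_embeddings_iff {u w : Word} {E : Finset ℕ}
    (hE : ∀ p ∈ E, p + u.length ≤ w.length) :
    E ⊆ embeddings u w ↔ ∀ q < w.length, cluster u E q ≤ val w q := by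
  constructor
  · intro h q hq
    refine max_le (one_le_val hq) (Finset.sup_le fun p hp => ?_)
    split_ifs with hpq
    · rcases Nat.lt_or_ge (q - p) u.length with hlt | hge
      · have := (mem_embeddings.1 (h hp)).2 _ hlt
        rwa [Nat.add_sub_cancel' hpq] at this
      · rw [val_of_le hge]
        exact Nat.zero_le _
    · exact Nat.zero_le _
  · intro h p hp
    refine mem_embeddings.2 ⟨hE p hp, fun i hi => ?_⟩
    have h1 := h (p + i) (by have := hE p hp; omega)
    refine le_trans (le_trans ?_ (le_max_right _ _)) h1
    have := le_sup (f := fun r => if r ≤ p + i then val u (p + i - r) else 0) hp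
    simpa using this

/-- The height of the least word of length `L` into which `u` embeds at all positions in `E`. -/
def clusterHeight (u : Word) (E : Finset ℕ) (L : ℕ) : ℕ := ∑ q ∈ range L, cluster u E q

/-! ### Equivalence in terms of cluster heights. -/

theorem SSWilf.refl (u : Word) : SSWilf u u := ⟨Equiv.refl _, fun _ => ⟨rfl, rfl⟩, fun _ => rfl⟩

theorem SSWilf.symm {u v : Word} (h : SSWilf u v) : SSWilf v u := by
  obtain ⟨f, h1, h2⟩ := h
  refine ⟨f.symm, fun w => ?_, fun w => ?_⟩
  · have := h1 (f.symm w)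
    rw [f.apply_symm_apply] at this
    exact ⟨this.1.symm, this.2.symm⟩
  · have := h2 (f.symm w)
    rw [f.apply_symm_apply] at this
    exact this.symm

theorem SSWilf.trans {u v w : Word} (h : SSWilf u v) (h' : SSWilf v w) : SSWilf u w := by
  obtain ⟨f, h1, h2⟩ := h
  obtain ⟨g, h3, h4⟩ := h'
  exact ⟨f.trans g, fun x => ⟨(h3 _).1.trans (h1 x).1, (h3 _).2.trans (h1 x).2⟩,
    fun x => (h2 x).trans (h4 _)⟩

/-- The bijection sends the minimal word for `u` and `E` to a word of the same height in which `v`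
embeds at all of `E`. -/
theorem SSWilf.clusterHeight_le {u v : Word} (h : SSWilf u v) {E : Finset ℕ} {L : ℕ}
    (hu : ∀ p ∈ E, p + u.length ≤ L) (hv : ∀ p ∈ E, p + v.length ≤ L) :
    clusterHeight v E L ≤ clusterHeight u E L := by
  obtain ⟨f, h1, h2⟩ := h
  set w := ofVals L (cluster u E)
  have hw : w.length = L := length_ofVals _ _
  have hsub : E ⊆ embeddings u w := by
    rw [subset_embeddings_iff (by rwa [hw]), hw]
    exact fun q hq => (val_ofVals hq (one_le_cluster u E q)).ge
  have hfw : (f w).length = L := (h1 w).1.trans hw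
  rw [Em_eq_Em_iff.1 (h2 w), subset_embeddings_iff (by rwa [hfw]), hfw] at hsub
  have hhw : height w = clusterHeight u E L := height_ofVals fun q _ => one_le_cluster u E q
  rw [← hhw, ← (h1 w).2, height_eq_sum, hfw]
  exact sum_le_sum fun q hq => hsub q (mem_range.1 hq)

theorem SSWilf.clusterHeight_eq {u v : Word} (h : SSWilf u v) {E : Finset ℕ} {L : ℕ}
    (hu : ∀ p ∈ E, p + u.length ≤ L) (hv : ∀ p ∈ E, p + v.length ≤ L) :
    clusterHeight u E L = clusterHeight v E L :=
  le_antisymm (h.symm.clusterHeight_le hv hu) (h.clusterHeight_le hu hv)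

theorem finite_length_height (L h : ℕ) : {w : Word | w.length = L ∧ height w = h}.Finite := by
  refine ((List.finite_length_eq (Fin (h + 1)) L).image
    (List.map fun a : Fin (h + 1) => (a : ℕ).toPNat')).subset ?_
  rintro w ⟨rfl, rfl⟩
  refine ⟨w.map fun a : ℕ+ => Fin.ofNat (height w + 1) (a : ℕ), by simp, ?_⟩
  rw [List.map_map]
  conv_rhs => rw [← List.map_id w]
  refine List.map_congr_left fun a ha => ?_
  have hle : (a : ℕ) ≤ height w :=
    List.single_le_sum (fun _ _ => Nat.zero_le _) _ (List.mem_map_of_mem ha)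
  simp [Nat.mod_eq_of_lt (Nat.lt_succ_of_le hle)]

/-- The words of length `L` and height `h`. -/
noncomputable def wordsOf (L h : ℕ) : Finset Word := (finite_length_height L h).toFinset

theorem mem_wordsOf {L h : ℕ} {w : Word} : w ∈ wordsOf L h ↔ w.length = L ∧ height w = h := by
  simp [wordsOf]

/-- Only the excess of a word over the minimal one is free. Moving this excess from the cluster of
`u` to that of `v` is injective and preserves length and, by `hc`, height. -/
theorem card_filter_subset_embeddings_le {u v : Word} {E : Finset ℕ} {L h : ℕ}
    (hlen : u.length = v.length) (hE : ∀ p ∈ E, p + u.length ≤ L)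
    (hc : clusterHeight u E L = clusterHeight v E L) :
    ((wordsOf L h).filter fun w => E ⊆ embeddings u w).card ≤
      ((wordsOf L h).filter fun w => E ⊆ embeddings v w).card := by
  have hdom : ∀ w ∈ (wordsOf L h).filter (fun w => E ⊆ embeddings u w),
      w.length = L ∧ height w = h ∧ ∀ q < L, cluster u E q ≤ val w q := by
    intro w hw
    obtain ⟨hw, hsub⟩ := mem_filter.1 hw
    obtain ⟨hl, hh⟩ := mem_wordsOf.1 hw
    rw [subset_embeddings_iff (by rwa [hl]), hl] at hsub
    exact ⟨hl, hh, hsub⟩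
  have hone : ∀ (w : Word) (q : ℕ), 1 ≤ val w q - cluster u E q + cluster v E q :=
    fun w q => le_add_left (one_le_cluster v E q)
  refine card_le_card_of_injOn
    (fun w => ofVals L fun q => val w q - cluster u E q + cluster v E q) ?_ ?_
  · intro w hw
    obtain ⟨hl, hh, hq⟩ := hdom w hw
    refine mem_coe.2 (mem_filter.2 ⟨mem_wordsOf.2 ⟨length_ofVals _ _, ?_⟩, ?_⟩)
    · have hsum : ∑ q ∈ range L, (val w q - cluster u E q) + clusterHeight u E L = h := by
        rw [clusterHeight, ← sum_add_distrib, ← hh, height_eq_sum, hl]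
        exact sum_congr rfl fun q hq' => Nat.sub_add_cancel (hq q (mem_range.1 hq'))
      rw [height_ofVals fun q _ => hone w q, sum_add_distrib]
      rw [hc] at hsum
      exact hsum
    · rw [subset_embeddings_iff (by rwa [length_ofVals, ← hlen]), length_ofVals]
      intro q hq'
      rw [val_ofVals hq' (hone w q)]
      exact Nat.le_add_left _ _
  · intro w hw w' hw' heq
    obtain ⟨hl, -, hq⟩ := hdom w hw
    obtain ⟨hl', -, hq'⟩ := hdom w' hw'
    refine word_ext (hl.trans hl'.symm) fun q hqw => ?_
    rw [hl] at hqw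
    have h1 := congrArg (fun x => val x q) heq
    simp only at h1
    rw [val_ofVals hqw (hone w q), val_ofVals hqw (hone w' q)] at h1
    have := hq q hqw
    have := hq' q hqw
    omega

theorem sSWilf_of_clusterHeight_eq {u v : Word} (hlen : u.length = v.length)
    (hc : ∀ L E, (∀ p ∈ E, p + u.length ≤ L) → clusterHeight u E L = clusterHeight v E L) :
    SSWilf u v := by
  have hsub : ∀ L h E, ((wordsOf L h).filter fun w => E ⊆ embeddings u w).card =
      ((wordsOf L h).filter fun w => E ⊆ embeddings v w).card := by
    intro L h E
    by_cases hE : ∀ p ∈ E, p + u.length ≤ L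
    · exact le_antisymm (card_filter_subset_embeddings_le hlen hE (hc L E hE))
        (card_filter_subset_embeddings_le hlen.symm (by rwa [← hlen]) (hc L E hE).symm)
    · push Not at hE
      obtain ⟨p, hp, hlt⟩ := hE
      rw [filter_false_of_mem, filter_false_of_mem]
      · intro w hw hcon
        have := (mem_embeddings.1 (hcon hp)).1
        rw [(mem_wordsOf.1 hw).1] at this
        omega
      · intro w hw hcon
        have := (mem_embeddings.1 (hcon hp)).1
        rw [(mem_wordsOf.1 hw).1] at this
        omega
  let key : Word → Word → ℕ × ℕ × Finset ℕ := fun x w => (w.length, height w, embeddings x w)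
  have hfib : ∀ x c w, w ∈ (wordsOf c.1 c.2.1).filter (fun w => embeddings x w = c.2.2) ↔
      key x w = c := by
    intro x c w
    rw [mem_filter, mem_wordsOf]
    simp only [key, Prod.ext_iff, and_assoc]
  -- For fixed length, height and exact embedding set there are equally many words for `u` and for
  -- `v`; the fibrewise bijections are then glued.
  have e : ∀ c, {w // key u w = c} ≃ {w // key v w = c} := fun c =>
    (Equiv.subtypeEquivRight fun w => (hfib u c w).symm).trans
      ((equivOfCardEq (card_filter_eq_of_card_filter_subset (hsub c.1 c.2.1) c.2.2)).trans
        (Equiv.subtypeEquivRight fun w => hfib v c w))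
  refine ⟨Equiv.ofFiberEquiv e, fun w => ?_, fun w => ?_⟩
  · have := Equiv.ofFiberEquiv_map e w
    simp only [key, Prod.mk.injEq] at this
    exact ⟨this.1, this.2.1⟩
  · have := Equiv.ofFiberEquiv_map e w
    simp only [key, Prod.mk.injEq] at this
    exact Em_eq_Em_iff.2 this.2.2.symm

/-! ### Level sets. -/

/-- The (0-based) positions of the letters of `u` that are at least `i`. -/
def levelSet (u : Word) (i : ℕ) : Finset ℕ := (range u.length).filter fun p => i ≤ val u p

theorem le_cluster_iff {u : Word} {E : Finset ℕ} {i q : ℕ} (hi : 2 ≤ i) :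
    i ≤ cluster u E q ↔ q ∈ levelSet u i + E := by
  rw [cluster, le_max_iff, or_iff_right (by omega), Finset.le_sup_iff (by simp; omega), mem_add]
  constructor
  · rintro ⟨p, hp, h⟩
    split_ifs at h with hpq
    · refine ⟨q - p, mem_filter.2 ⟨mem_range.2 ?_, h⟩, p, hp, Nat.sub_add_cancel hpq⟩
      by_contra hcon
      rw [val_of_le (by omega)] at h
      omega
    · omega
  · rintro ⟨r, hr, p, hp, rfl⟩
    refine ⟨p, hp, ?_⟩
    rw [if_pos (by omega), Nat.add_sub_cancel]
    exact (mem_filter.1 hr).2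

/-- Layer-cake summation: each letter is the number of levels it reaches. Level 1 contributes `L`
whatever `E` is, since every letter is at least 1. -/
theorem clusterHeight_eq_sum {u : Word} {n L : ℕ} {E : Finset ℕ} (hn : 1 ≤ n)
    (hu : ∀ q, val u q ≤ n) (hE : ∀ p ∈ E, p + u.length ≤ L) :
    clusterHeight u E L = L + ∑ i ∈ Ico 2 (n + 1), (levelSet u i + E).card := by
  have hle : ∀ q, cluster u E q ≤ n := by
    intro q
    refine max_le hn (Finset.sup_le fun p _ => ?_)
    split_ifs
    · exact hu _
    · exact Nat.zero_le _
  have hcl : ∀ q, cluster u E q = 1 + ((Ico 2 (n + 1)).filter fun i => i ≤ cluster u E q).card := by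
    intro q
    have : (Ico 2 (n + 1)).filter (fun i => i ≤ cluster u E q) = Ico 2 (cluster u E q + 1) := by
      ext i
      have := hle q
      simp only [mem_filter, mem_Ico]
      omega
    have h1 := one_le_cluster u E q
    rw [this, Nat.card_Ico]
    omega
  rw [clusterHeight, sum_congr rfl fun q _ => hcl q, sum_add_distrib]
  congr 1
  · simp
  · refine (sum_card_bipartiteAbove_eq_sum_card_bipartiteBelow (s := range L) (t := Ico 2 (n + 1))
      fun q i => i ≤ cluster u E q).trans ?_
    refine sum_congr rfl fun i hi => ?_
    congr 1
    ext q
    rw [mem_bipartiteBelow, le_cluster_iff (mem_Ico.1 hi).1, mem_range, and_iff_right_iff_imp,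
      mem_add]
    rintro ⟨r, hr, p, hp, rfl⟩
    have := mem_range.1 (mem_filter.1 hr).1
    have := hE p hp
    omega

/-! ### Permutations, their inverses and the translate criterion. -/

theorem mem_Sym_iff {n : ℕ} {w : Word} :
    w ∈ Sym n ↔ (w.map fun a : ℕ+ => (a : ℕ)) ∈ orderings (Icc 1 n) := by
  rw [mem_orderings, List.nodup_map_iff PNat.coe_injective]
  refine and_congr_right fun _ => ⟨fun h => ?_, fun h a => ?_⟩
  · ext x
    simp only [List.mem_toFinset, List.mem_map, mem_Icc]
    constructor
    · rintro ⟨a, ha, rfl⟩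
      exact ⟨a.pos, (h a).1 ha⟩
    · rintro ⟨h1, h2⟩
      exact ⟨⟨x, h1⟩, (h _).2 h2, rfl⟩
  · have := Finset.ext_iff.1 h a
    simp only [List.mem_toFinset, List.mem_map, mem_Icc, PNat.coe_inj, exists_eq_right] at this
    rw [this]
    exact and_iff_right a.pos

theorem exists_map_coe_of_mem_orderings {n : ℕ} {l : List ℕ} (hl : l ∈ orderings (Icc 1 n)) :
    ∃ w ∈ Sym n, (w.map fun a : ℕ+ => (a : ℕ)) = l := by
  have : l ∈ Set.range (List.map fun a : ℕ+ => (a : ℕ)) := by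
    rw [Set.range_list_map]
    intro x hx
    rw [← List.mem_toFinset, (mem_orderings.1 hl).2, mem_Icc] at hx
    exact ⟨⟨x, hx.1⟩, rfl⟩
  obtain ⟨w, rfl⟩ := this
  exact ⟨w, mem_Sym_iff.2 hl, rfl⟩

/-- The inverse of a permutation of `{1, …, n}` given as a list. -/
def inverseList (n : ℕ) (l : List ℕ) : List ℕ := (List.range' 1 n).map fun a => l.idxOf a + 1

theorem inverseList_mem_orderings {n : ℕ} {l : List ℕ} (hl : l ∈ orderings (Icc 1 n)) :
    inverseList n l ∈ orderings (Icc 1 n) := by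
  have hlen : l.length = n := by simpa using length_of_mem_orderings hl
  have hmem : ∀ a, a ∈ l ↔ 1 ≤ a ∧ a ≤ n := fun a => by
    rw [← List.mem_toFinset, (mem_orderings.1 hl).2, mem_Icc]
  have hnd : (inverseList n l).Nodup := by
    refine List.Nodup.map_on (fun a ha b _ hab => ?_) List.nodup_range'
    rw [List.mem_range'_1] at ha
    exact (List.idxOf_inj ((hmem a).2 (by omega))).1 (by omega)
  refine mem_orderings.2 ⟨hnd, eq_of_subset_of_card_le ?_ ?_⟩
  · intro x hx
    obtain ⟨a, ha, rfl⟩ := List.mem_map.1 (List.mem_toFinset.1 hx)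
    rw [List.mem_range'_1] at ha
    have := List.idxOf_lt_length_of_mem ((hmem a).2 (by omega))
    exact mem_Icc.2 (by omega)
  · rw [List.toFinset_card_of_nodup hnd]
    simp [inverseList]

theorem inverseList_inverseList {n : ℕ} {l : List ℕ} (hl : l ∈ orderings (Icc 1 n)) :
    inverseList n (inverseList n l) = l := by
  have hlen : l.length = n := by simpa using length_of_mem_orderings hl
  have hnd := (mem_orderings.1 hl).1
  have hnd' := (mem_orderings.1 (inverseList_mem_orderings hl)).1
  have hlen' : (inverseList n l).length = n := by simp [inverseList]
  refine List.ext_getElem (by simp [inverseList, hlen]) fun i h1 h2 => ?_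
  have hmem : 1 ≤ l[i] ∧ l[i] ≤ n := by
    rw [← mem_Icc, ← (mem_orderings.1 hl).2, List.mem_toFinset]
    exact List.getElem_mem h2
  have hget : (inverseList n l)[l[i] - 1]'(by omega) = i + 1 := by
    simp only [inverseList, List.getElem_map, List.getElem_range']
    rw [show 1 + 1 * (l[i] - 1) = l[i] by omega, hnd.idxOf_getElem]
  have hidx := hnd'.idxOf_getElem (l[i] - 1) (by omega)
  rw [hget] at hidx
  have : (inverseList n (inverseList n l))[i] = (inverseList n l).idxOf (i + 1) + 1 := by
    rw [List.getElem_of_eq (show inverseList n (inverseList n l) =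
      (List.range' 1 n).map fun a => (inverseList n l).idxOf a + 1 from rfl)]
    rw [List.getElem_map, List.getElem_range']
    congr 2
    omega
  omega

/-- The list of (1-based) positions of the letters `1, …, n` in a permutation of `{1, …, n}`. -/
def inverseWord (n : ℕ) (w : Word) : List ℕ := inverseList n (w.map fun a : ℕ+ => (a : ℕ))

theorem bijOn_inverseWord (n : ℕ) :
    Set.BijOn (inverseWord n) (Sym n) (orderings (Icc 1 n) : Set (List ℕ)) := by
  refine ⟨fun w hw => inverseList_mem_orderings (mem_Sym_iff.1 hw), ?_, ?_⟩
  · intro w hw w' hw' h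
    have := congrArg (inverseList n) h
    rw [inverseWord, inverseWord, inverseList_inverseList (mem_Sym_iff.1 hw),
      inverseList_inverseList (mem_Sym_iff.1 hw')] at this
    exact List.map_injective_iff.2 PNat.coe_injective this
  · intro l hl
    obtain ⟨w, hw, hwl⟩ := exists_map_coe_of_mem_orderings (inverseList_mem_orderings hl)
    exact ⟨w, hw, by rw [inverseWord, hwl, inverseList_inverseList hl]⟩

theorem length_of_mem_Sym {n : ℕ} {w : Word} (hw : w ∈ Sym n) : w.length = n := by
  simpa using length_of_mem_orderings (mem_Sym_iff.1 hw)

theorem val_le_of_mem_Sym {n : ℕ} {w : Word} (hw : w ∈ Sym n) (q : ℕ) : val w q ≤ n := by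
  rcases Nat.lt_or_ge q w.length with h | h
  · rw [val_of_lt h]
    exact (hw.2 _).1 (List.getElem_mem h)
  · rw [val_of_le h]
    exact Nat.zero_le _

/-- Dropping `k` entries of the inverse leaves the positions of the letters `k + 1, …, n`; the shift
by 1 passes from 0-based to 1-based positions. -/
theorem toFinset_drop_inverseWord {n : ℕ} {w : Word} (hw : w ∈ Sym n) (k : ℕ) :
    ((inverseWord n w).drop k).toFinset = levelSet w (k + 1) + {1} := by
  have hl := mem_Sym_iff.1 hw
  have hlen := length_of_mem_Sym hw
  ext x
  rw [inverseWord, inverseList, ← List.map_drop, List.drop_range', mem_add_singleton]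
  simp only [List.mem_toFinset, List.mem_map, List.mem_range'_1, levelSet, mem_filter, mem_range]
  constructor
  · rintro ⟨a, ha, rfl⟩
    have ha' : a ∈ w.map fun a : ℕ+ => (a : ℕ) := by
      rw [← List.mem_toFinset, (mem_orderings.1 hl).2, mem_Icc]
      omega
    have hidx := List.idxOf_lt_length_of_mem ha'
    refine ⟨_, ⟨by simpa using hidx, ?_⟩, rfl⟩
    rw [val, List.getD_eq_getElem _ _ hidx, List.getElem_idxOf]
    omega
  · rintro ⟨q, ⟨hq, hk⟩, rfl⟩
    refine ⟨val w q, ?_, ?_⟩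
    · have := val_le_of_mem_Sym hw q
      omega
    · rw [val, List.getD_eq_getElem _ _ (by simpa using hq),
        (mem_orderings.1 hl).1.idxOf_getElem]

theorem card_levelSet {n : ℕ} {w : Word} (hw : w ∈ Sym n) {i : ℕ} (hi : 1 ≤ i) :
    (levelSet w i).card = n + 1 - i := by
  obtain ⟨k, rfl⟩ : ∃ k, i = k + 1 := ⟨i - 1, by omega⟩
  have hl := (bijOn_inverseWord n).mapsTo hw
  rw [← card_add_singleton _ 1, ← toFinset_drop_inverseWord hw, List.toFinset_card_of_nodup
    ((mem_orderings.1 hl).1.sublist (List.drop_sublist _ _)), List.length_drop,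
    length_of_mem_orderings hl]
  simp

theorem levelSet_one (w : Word) : levelSet w 1 = range w.length :=
  filter_true_of_mem fun _ hq => one_le_val (mem_range.1 hq)

theorem sSWilf_iff_translate_levelSet {n : ℕ} (hn : 1 ≤ n) {u v : Word} (hu : u ∈ Sym n)
    (hv : v ∈ Sym n) :
    SSWilf u v ↔ ∀ i ∈ Ico 1 (n + 1), Translate (levelSet u i) (levelSet v i) := by
  have hul := length_of_mem_Sym hu
  have hvl := length_of_mem_Sym hv
  constructor
  · intro h i hi
    refine translate_of_sum_card_add_eq (fun i hi => card_levelSet hu (mem_Ico.1 hi).1)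
      (fun i hi => card_levelSet hv (mem_Ico.1 hi).1) (fun E => ?_) hi
    have hlt : 1 < n + 1 := by omega
    -- Cluster heights see only levels from 2 on; level 1 is `range n` for both words and can be
    -- added.
    rw [sum_eq_sum_Ico_succ_bot hlt fun i => (levelSet u i + E).card,
      sum_eq_sum_Ico_succ_bot hlt fun i => (levelSet v i + E).card, levelSet_one,
      levelSet_one, hul, hvl]
    congr 1
    have hE : ∀ p ∈ E, p + n ≤ E.sup id + n :=
      fun p hp => Nat.add_le_add_right (le_sup (f := id) hp) n
    have := h.clusterHeight_eq (by rwa [hul]) (by rwa [hvl])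
    rw [clusterHeight_eq_sum hn (val_le_of_mem_Sym hu) (by rwa [hul]),
      clusterHeight_eq_sum hn (val_le_of_mem_Sym hv) (by rwa [hvl])] at this
    exact Nat.add_left_cancel this
  · intro h
    refine sSWilf_of_clusterHeight_eq (hul.trans hvl.symm) fun L E hE => ?_
    rw [clusterHeight_eq_sum hn (val_le_of_mem_Sym hu) hE,
      clusterHeight_eq_sum hn (val_le_of_mem_Sym hv) (by rwa [hvl, ← hul])]
    congr 1
    refine sum_congr rfl fun i hi => (h i ?_).card_add_eq E
    rw [mem_Ico] at hi ⊢
    omega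

theorem sSWilf_iff_suffixTranslate {n : ℕ} (hn : 1 ≤ n) {u v : Word} (hu : u ∈ Sym n)
    (hv : v ∈ Sym n) : SSWilf u v ↔ SuffixTranslate (inverseWord n u) (inverseWord n v) := by
  have htr : ∀ i, Translate (levelSet u (i + 1)) (levelSet v (i + 1)) ↔
      Translate ((inverseWord n u).drop i).toFinset ((inverseWord n v).drop i).toFinset := by
    intro i
    rw [toFinset_drop_inverseWord hu, toFinset_drop_inverseWord hv, translate_add_singleton_iff]
    exact ⟨fun h => (translate_add_singleton_iff.2 h.symm).symm,
      fun h => (translate_add_singleton_iff.1 h.symm).symm⟩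
  rw [sSWilf_iff_translate_levelSet hn hu hv]
  constructor
  · intro h
    refine ⟨by simp [inverseWord, inverseList], fun i => (htr i).1 ?_⟩
    rcases Nat.lt_or_ge i n with hi | hi
    · exact h _ (mem_Ico.2 (by omega))
    · have he : ∀ w ∈ Sym n, levelSet w (i + 1) = ∅ := fun w hw => by
        rw [← card_eq_zero, card_levelSet hw (by omega)]
        omega
      rw [he u hu, he v hv]
      exact Translate.refl _
  · rintro ⟨-, h⟩ i hi
    obtain ⟨k, rfl⟩ : ∃ k, i = k + 1 := ⟨i - 1, by rw [mem_Ico] at hi; omega⟩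
    exact (htr k).2 (h k)

/-! ### Counting classes and first returns. -/

theorem finite_Sym (n : ℕ) : (Sym n).Finite :=
  (bijOn_inverseWord n).finite_iff_finite.2 (finite_toSet _)

theorem ncard_ssClass {n : ℕ} (hn : 1 ≤ n) {u : Word} (hu : u ∈ Sym n) :
    (ssClass n u).ncard = 2 ^ endCount (inverseWord n u) := by
  classical
  have hbij := bijOn_inverseWord n
  have hu' := mem_orderings.1 (hbij.mapsTo hu)
  rw [← card_filter_suffixTranslate hu'.1 (B := Icc 1 n) (by rw [hu'.2]; exact Translate.refl _),
    ← Set.ncard_coe_finset, ← (hbij.injOn.mono fun v hv => hv.1).ncard_image]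
  congr 1
  ext l
  rw [mem_coe, mem_filter]
  constructor
  · rintro ⟨v, ⟨hv, huv⟩, rfl⟩
    exact ⟨hbij.mapsTo hv, ((sSWilf_iff_suffixTranslate hn hu hv).1 huv).symm⟩
  · rintro ⟨hl, h⟩
    obtain ⟨v, hv, rfl⟩ := hbij.surjOn hl
    exact ⟨v, ⟨hv, (sSWilf_iff_suffixTranslate hn hu hv).2 h.symm⟩, rfl⟩

theorem ssClass_eq_iff {n : ℕ} {u v : Word} (hv : v ∈ Sym n) :
    ssClass n v = ssClass n u ↔ v ∈ ssClass n u := by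
  constructor
  · intro h
    rw [← h]
    exact ⟨hv, SSWilf.refl v⟩
  · rintro ⟨-, h⟩
    ext w
    exact and_congr_right fun _ => ⟨fun h' => h.trans h', fun h' => h.symm.trans h'⟩

/-- The permutations whose class has `2 ^ j` elements are counted twice: class by class, and through
their inverses by `endCount`. -/
theorem two_pow_mul_s {n : ℕ} (hn : 1 ≤ n) (j : ℕ) :
    2 ^ j * s j n = endCountCard (Icc 1 n) j := by
  classical
  have hfin : {u ∈ Sym n | (ssClass n u).ncard = 2 ^ j}.Finite :=
    (finite_Sym n).subset fun u hu => hu.1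
  set T := hfin.toFinset
  have hT : ∀ u, u ∈ T ↔ u ∈ Sym n ∧ (ssClass n u).ncard = 2 ^ j := fun u => by simp [T]
  have hs : s j n = (T.image (ssClass n)).card := by
    rw [s, ← Set.ncard_coe_finset]
    congr 1
    ext C
    simp only [Set.mem_ofPred_eq, coe_image, Set.mem_image, mem_coe, hT]
    constructor
    · rintro ⟨⟨u, hu, rfl⟩, hC⟩
      exact ⟨u, ⟨hu, hC⟩, rfl⟩
    · rintro ⟨u, ⟨hu, hC⟩, rfl⟩
      exact ⟨⟨u, hu, rfl⟩, hC⟩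
  have hfiber : ∀ C ∈ T.image (ssClass n), (T.filter fun u => ssClass n u = C).card = 2 ^ j := by
    intro C hC
    obtain ⟨u, hu, rfl⟩ := mem_image.1 hC
    obtain ⟨hu, hcard⟩ := (hT u).1 hu
    rw [← hcard, ← Set.ncard_coe_finset]
    congr 1
    ext v
    rw [mem_coe, mem_filter, hT]
    constructor
    · rintro ⟨⟨hv, -⟩, h⟩
      exact (ssClass_eq_iff hv).1 h
    · intro hv
      have h := (ssClass_eq_iff hv.1).2 hv
      exact ⟨⟨hv.1, by rw [h, hcard]⟩, h⟩
  have hTcard : T.card = endCountCard (Icc 1 n) j := by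
    have hbij := bijOn_inverseWord n
    rw [endCountCard, ← card_image_of_injOn (f := inverseWord n) (s := T)
      (hbij.injOn.mono fun u hu => ((hT u).1 hu).1)]
    congr 1
    ext l
    rw [mem_image, mem_filter]
    constructor
    · rintro ⟨u, hu, rfl⟩
      obtain ⟨hu, hcard⟩ := (hT u).1 hu
      rw [ncard_ssClass hn hu] at hcard
      exact ⟨hbij.mapsTo hu, Nat.pow_right_injective le_rfl hcard⟩
    · rintro ⟨hl, rfl⟩
      obtain ⟨u, hu, rfl⟩ := hbij.surjOn hl
      exact ⟨u, (hT u).2 ⟨hu, ncard_ssClass hn hu⟩, rfl⟩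
  rw [← hTcard, card_eq_sum_card_image (ssClass n), sum_congr rfl hfiber, sum_const, hs,
    smul_eq_mul, mul_comm]

theorem d_eq_card_firstReturn (k n : ℕ) : d k n = (firstReturn k n).card := by
  rw [d, ← Set.ncard_coe_finset,
    ← Set.ncard_image_of_injective _ (List.map_injective_iff.2 PNat.coe_injective)]
  congr 1
  ext l
  have hiff : ∀ u : Word, (u.length = k ∧ Periodic (remaining n u) ∧
      ∀ j, 1 ≤ j → j < k → ¬ Periodic (remaining n (u.take j))) ↔
        IsFirstReturn k n (u.map fun a : ℕ+ => (a : ℕ)) := fun u => by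
    simp only [IsFirstReturn, periodic_iff_isAP, remaining, List.length_map, List.map_take]
  rw [mem_coe, mem_firstReturn, Set.mem_image]
  constructor
  · rintro ⟨u, ⟨hlen, ⟨w, hw, huw⟩, h⟩, rfl⟩
    refine ⟨⟨_, mem_Sym_iff.1 hw, ?_⟩, (hiff u).1 ⟨hlen, h⟩⟩
    rw [← List.map_take, ← hlen, ← List.prefix_iff_eq_take.1 huw]
  · rintro ⟨⟨l, hl, rfl⟩, h⟩
    obtain ⟨w, hw, rfl⟩ := exists_map_coe_of_mem_orderings hl
    rw [← List.map_take] at h ⊢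
    obtain ⟨hlen, h⟩ := (hiff _).2 h
    exact ⟨w.take k, ⟨hlen, ⟨w, hw, List.take_prefix k w⟩, h⟩, rfl⟩

end SuperStrongWilf

theorem theorem3p8 (n j : ℕ) (hn : 4 ≤ n) (hj : 1 ≤ j) (hjn : j ≤ n - 1) :
    SuperStrongWilf.s j n =
      SuperStrongWilf.s (j - 1) (n - 1) +
        ∑ k ∈ Finset.Icc 2 (n - j - 1), SuperStrongWilf.d k n * SuperStrongWilf.s j (n - k) := by
  have key := SuperStrongWilf.endCountCard_Icc hn hj
  -- After multiplication by `2 ^ j`, the two choices of an end absorb the factor in `2 * 2 ^ (j -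
  -- 1) = 2 ^ j`.
  refine Nat.eq_of_mul_eq_mul_left (pow_pos two_pos j) ?_
  rw [SuperStrongWilf.two_pow_mul_s (by omega), key,
    ← SuperStrongWilf.two_pow_mul_s (n := n - 1) (by omega), ← mul_assoc, ← pow_succ',
    Nat.sub_add_cancel hj, mul_add, Finset.mul_sum]
  congr 1
  refine Finset.sum_congr rfl fun k hk => ?_
  rw [Finset.mem_Icc] at hk
  rw [← SuperStrongWilf.two_pow_mul_s (by omega), SuperStrongWilf.d_eq_card_firstReturn,
    mul_left_comm]
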